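/- **Setting.** For a complex Hilbert space $H$ and $\rho>0$, let $C_\rho(H)$ be the set of bounded operators $T$ on $H$ having a unitary $\rho$-dilation: there are a Hilbert space $\mathcal H\supseteq H$ and a unitary operator $W$ on $\mathcal H$ with $T^m=\rho P_H W^m|_H$ for all $m\ge 1$. Put $w_\rho(T)=\inf\{\gamma>0:\gamma^{-1}T\in C_\rho(H)\}$. For $T_0,T_1\in C_\rho(H)$, $T_1$ is Harnack dominated by $T_0$ if there is $c\ge 1$ such that $\operatorname{Re}p(T_1)\le c^2\operatorname{Re}p(T_0)+(c^2-1)(\rho-1)\operatorname{Re}p(0_H)$ for every polynomial $p$ with $\operatorname{Re}p\ge 0$ on $\overline{\mathbb D}$; $T_0$ and $T_1$ are Harnack equivalent in $C_\rho(H)$ if each is Harnack dominated by the other. Let $$K_z^\rho(T)=(I-\bar zT)^{-1}+(I-zT^*)^{-1}+(\rho-2)I$$ whenever $I-\bar zT$ is invertible. Let $n\ge 1$, and let $S_{n+1}(b)$ be the $(n+1)\times(n+1)$ matrix with entries $b$ on the first superdiagonal and $0$ elsewhere. Let $S=S_{n+1}(a)$ with $a=w_\rho(S_{n+1}(1))^{-1}$,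 an operator on $\mathbb C^{n+1}$ with canonical basis $e_0,\dots,e_n$. **Proposition 3.4 (orbit).** Let $n\ge1$ and let $\rho>0$ with $\rho\ne 1$. There is a nonzero vector $v=(v_0,\dots,v_n)\in\mathbb C^{n+1}$ such that $$\ker K_z^\rho(S)=\mathbb C\,(v_0,zv_1,\dots,z^nv_n)\qquad\text{for all } z\in\mathbb T .$$ For every such $v$ and every unitary $(n+1)\times(n+1)$ matrix $U$, the operator $U^*SU$ is Harnack equivalent to $S$ in $C_\rho(\mathbb C^{n+1})$ if and only if there is $\alpha\in\mathbb T$ with $Ue_k=\alpha e_k$ for every $k$ such that $v_k\ne 0$. -/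

import Mathlib

noncomputable section

namespace HarnackShift

open ComplexConjugate

universe u

section General

variable {H : Type u} [NormedAddCommGroup H] [InnerProductSpace ℂ H] [CompleteSpace H]

/-- The class `C_ρ(H)`: `T` has a unitary `ρ`-dilation, i.e. there are a Hilbert space `K`, an
isometric embedding `J : H → K` and a unitary operator `W` on `K` such that
`T ^ m = ρ P_H W ^ m |_H` for all `m ≥ 1`. With `H` identified with the closed subspace `J(H)`,
the compression `P_H W ^ m |_H` is `J⋆ W ^ m J`. -/
def IsRhoContraction (ρ : ℝ) (T : H →L[ℂ] H) : Prop :=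
  ∃ (K : Type u) (_ : NormedAddCommGroup K) (_ : InnerProductSpace ℂ K) (_ : CompleteSpace K)
    (J : H →ₗᵢ[ℂ] K) (W : K →L[ℂ] K),
    W ∈ unitary (K →L[ℂ] K) ∧
    ∀ m : ℕ, 1 ≤ m →
      T ^ m = (ρ : ℂ) • ((ContinuousLinearMap.adjoint J.toContinuousLinearMap) ∘L
        (W ^ m) ∘L J.toContinuousLinearMap)

/-- The `ρ`-numerical radius `w_ρ(T) = inf {γ > 0 : γ⁻¹ T ∈ C_ρ(H)}`. -/
def rhoRadius (ρ : ℝ) (T : H →L[ℂ] H) : ℝ :=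
  sInf {γ : ℝ | 0 < γ ∧ IsRhoContraction ρ (((γ⁻¹ : ℝ) : ℂ) • T)}

/-- The real part `(A + A⋆) / 2` of an operator. -/
def rePart (A : H →L[ℂ] H) : H →L[ℂ] H :=
  (1 / 2 : ℂ) • (A + ContinuousLinearMap.adjoint A)

/-- `T₁` is Harnack dominated by `T₀` in `C_ρ(H)`: both operators belong to `C_ρ(H)` and, for some
constant `c ≥ 1`, `Re p(T₁) ≤ c² Re p(T₀) + (c² - 1)(ρ - 1) Re p(0_H)` for every polynomial `p`
with `Re p ≥ 0` on the closed unit disc. An inequality `A ≤ B` of operators means that `B - A`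
is positive. -/
def HarnackDominated (ρ : ℝ) (T₁ T₀ : H →L[ℂ] H) : Prop :=
  IsRhoContraction ρ T₁ ∧ IsRhoContraction ρ T₀ ∧
  ∃ c : ℝ, 1 ≤ c ∧ ∀ p : Polynomial ℂ,
    (∀ z : ℂ, ‖z‖ ≤ 1 → 0 ≤ (p.eval z).re) →
    (((c ^ 2 : ℝ) : ℂ) • rePart (Polynomial.aeval T₀ p)
      + (((c ^ 2 - 1) * (ρ - 1) : ℝ) : ℂ) • rePart (Polynomial.aeval (0 : H →L[ℂ] H) p)
      - rePart (Polynomial.aeval T₁ p)).IsPositive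

/-- Harnack equivalence in `C_ρ(H)`. -/
def HarnackEquivalent (ρ : ℝ) (T₁ T₀ : H →L[ℂ] H) : Prop :=
  HarnackDominated ρ T₁ T₀ ∧ HarnackDominated ρ T₀ T₁

/-- The operatorial `ρ`-kernel
`K_z^ρ(T) = (I - z̄ T)⁻¹ + (I - z T⋆)⁻¹ + (ρ - 2) I`
(used where `I - z̄ T` is invertible). -/
def rhoKernel (ρ : ℝ) (z : ℂ) (T : H →L[ℂ] H) : H →L[ℂ] H :=
  Ring.inverse (1 - conj z • T) + Ring.inverse (1 - z • ContinuousLinearMap.adjoint T)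
    + ((ρ - 2 : ℝ) : ℂ) • (1 : H →L[ℂ] H)

end General

/-- The operator on `ℂ^m` (with its Euclidean norm) given by a matrix in the canonical basis. -/
def toOp {m : ℕ} (A : Matrix (Fin m) (Fin m) ℂ) :
    EuclideanSpace ℂ (Fin m) →L[ℂ] EuclideanSpace ℂ (Fin m) :=
  Matrix.toEuclideanCLM (𝕜 := ℂ) (n := Fin m) A

/-- The truncated shift `S_m(b)`: entries `b` on the first superdiagonal and `0` elsewhere. -/
def truncShift (m : ℕ) (b : ℂ) : Matrix (Fin m) (Fin m) ℂ :=
  Matrix.of fun i j => if (i : ℕ) + 1 = (j : ℕ) then b else 0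

/-- The `w_ρ`-normalized truncated shift `S = S_{n+1}(a)` of size `n + 1`, where
`a = w_ρ(S_{n+1}(1))⁻¹`. -/
def normShift (ρ : ℝ) (n : ℕ) : Matrix (Fin (n + 1)) (Fin (n + 1)) ℂ :=
  truncShift (n + 1) (((rhoRadius ρ (toOp (truncShift (n + 1) 1)))⁻¹ : ℝ) : ℂ)

/-- `v = (v_0, …, v_n)` is a nonzero vector that describes the null spaces of the `ρ`-kernel
of `S`: for all `z` on the unit circle, `N(K_z^ρ(S)) = ℂ (v_0, z v_1, …, z^n v_n)`. -/
def IsNullVector (ρ : ℝ) (n : ℕ) (v : Fin (n + 1) → ℂ) : Prop :=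
  v ≠ 0 ∧ ∀ z : ℂ, ‖z‖ = 1 →
    LinearMap.ker (rhoKernel ρ z (toOp (normShift ρ n))).toLinearMap =
      Submodule.span ℂ {(WithLp.toLp 2 fun k : Fin (n + 1) => z ^ (k : ℕ) * v k :
        EuclideanSpace ℂ (Fin (n + 1)))}

end HarnackShift

end

noncomputable section

namespace HarnackShift

open ComplexConjugate

universe u

/-! ### Harnack domination as an inequality between `ρ`-kernels. -/

section General

variable {H : Type u} [NormedAddCommGroup H] [InnerProductSpace ℂ H]

/-! For a nilpotent `T`, averaging the `ρ`-kernel form of `T` against `Re p` over roots of unity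
gives `Re p(T) + (ρ - 1) Re p(0)`. Conversely, truncated Poisson kernels are admissible polynomials
whose values at `T` approach the kernel. So, for nilpotent members of the class, Harnack domination
of `T₁` by `T₀` means that `K_z(T₁) ≤ c² K_z(T₀)` on the unit circle with `c` independent of `z`
(`HarnackDominated.exists_kernelForm_le`, `harnackDominated_of_kernelForm_le`).

For the shift, `K_z(S) = D_z K D_z⋆` with `D_z = diag(z ^ k)` and `K` a Toeplitz matrix with entries
`ρ` on the diagonal and `a ^ |i - j|` off it. A scaled shift lies in the class exactly when its
Toeplitz matrix is positive, so at the extremal scale `a` the matrix is positive and singular: `K =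
B⋆B` with `B v = 0` for some `v ≠ 0` (`exists_normShift_factor`). Combining adjacent rows of `K`
shows, for `ρ ≠ 1`, that a null vector is determined by its first coordinate. The null space is
therefore a line `ℂ v`, with `v_0 ≠ 0` and, by reversal symmetry, `v_n ≠ 0`.

Since `K_z(U⋆SU) = U⋆ K_z(S) U`, domination forces `U` to preserve each line `ℂ D_z v`. Comparing
coefficients in `z` makes `U` a single scalar on the `e_k` with `v_k ≠ 0`
(`matrix_entry_of_forall_diagRotation`). Conversely, if `U` fixes these lines with a common scalar,
the two kernels vanish on the same line and are comparable modulo it, uniformly in `z`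
(`exists_kernelForm_map_le`). -/

lemma aeval_zero_eq (p : Polynomial ℂ) :
    Polynomial.aeval (0 : H →L[ℂ] H) p = p.coeff 0 • (1 : H →L[ℂ] H) := by
  rw [← Polynomial.coeff_zero_eq_aeval_zero', Algebra.algebraMap_eq_smul_one]

lemma re_inner_smul_one (c : ℂ) (x : H) :
    (inner ℂ x ((c • (1 : H →L[ℂ] H)) x)).re = c.re * ‖x‖ ^ 2 := by
  simp only [smul_apply, one_apply_eq_self, inner_smul_right,
    inner_self_eq_norm_sq_to_K]
  norm_cast
  exact Complex.re_mul_ofReal _ _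

lemma inner_aeval_of_pow_eq_zero {N : ℕ} {T : H →L[ℂ] H} (hT : T ^ N = 0) (p : Polynomial ℂ)
    {L : ℕ} (hNL : N ≤ L) (hL : p.natDegree < L) (x : H) :
    inner ℂ x (Polynomial.aeval T p x)
      = ∑ m ∈ Finset.range N, p.coeff m * inner ℂ x ((T ^ m) x) := by
  rw [Polynomial.aeval_eq_sum_range' hL, sum_apply, inner_sum]
  simp only [smul_apply, inner_smul_right]
  symm
  refine Finset.sum_subset (Finset.range_mono hNL) fun m _ hm => ?_
  rw [pow_eq_zero_of_le (by simpa using hm) hT]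
  simp

/-- The quadratic form of the `ρ`-kernel of an operator with `T ^ N = 0`. -/
def kernelForm (ρ : ℝ) (N : ℕ) (z : ℂ) (T : H →L[ℂ] H) (x : H) : ℝ :=
  (ρ - 2) * ‖x‖ ^ 2 + 2 * (∑ m ∈ Finset.range N, conj z ^ m * inner ℂ x ((T ^ m) x)).re

lemma sum_root_pow_mul_conj_pow {L : ℕ} {ζ : ℂ} (hζ : IsPrimitiveRoot ζ L) (hL : L ≠ 0) {a b : ℕ}
    (ha : a < L) (hb : b < L) :
    ∑ j ∈ Finset.range L, (ζ ^ j) ^ a * conj (ζ ^ j) ^ b = if a = b then (L : ℂ) else 0 := by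
  have hn : ‖ζ‖ = 1 := Complex.norm_eq_one_of_pow_eq_one hζ.pow_eq_one hL
  have hc : ζ * conj ζ = 1 := by rw [Complex.mul_conj, Complex.normSq_eq_norm_sq, hn]; simp
  have hc' : conj ζ ^ L = 1 := by rw [← map_pow, hζ.pow_eq_one, map_one]
  have hterm : ∀ j, (ζ ^ j) ^ a * conj (ζ ^ j) ^ b = (ζ ^ a * conj ζ ^ b) ^ j := by
    intro j; rw [map_pow, mul_pow, ← pow_mul, ← pow_mul, ← pow_mul, ← pow_mul, mul_comm j,
      mul_comm j]
  simp_rw [hterm]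
  split_ifs with hab
  · subst hab
    rw [← mul_pow, hc, one_pow]; simp
  · have hne : ζ ^ a * conj ζ ^ b ≠ 1 := by
      intro h
      apply hab
      apply hζ.pow_inj ha hb
      have : ζ ^ a * (ζ * conj ζ) ^ b = ζ ^ b := by
        rw [mul_pow]; linear_combination ζ ^ b * h
      rwa [hc, one_pow, mul_one] at this
    have h1 : (ζ ^ a * conj ζ ^ b) ^ L = 1 := by
      rw [mul_pow, ← pow_mul, ← pow_mul, mul_comm a, mul_comm b, pow_mul, pow_mul, hc',
        hζ.pow_eq_one]; simp
    have := mul_neg_geom_sum (ζ ^ a * conj ζ ^ b) L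
    rw [h1, sub_self, mul_eq_zero] at this
    exact this.resolve_left (sub_ne_zero.2 hne.symm)

/-- Averaging the kernel form against `Re p` over roots of unity recovers `Re p(T)`. -/
lemma sum_re_eval_mul_kernelForm (ρ : ℝ) {N : ℕ} (hN : 0 < N) {T : H →L[ℂ] H} (hT : T ^ N = 0)
    (p : Polynomial ℂ) {L : ℕ} (hLN : N + p.natDegree < L) {ζ : ℂ}
    (hζ : IsPrimitiveRoot ζ L) (x : H) :
    ∑ j ∈ Finset.range L, (p.eval (ζ ^ j)).re * kernelForm ρ N (ζ ^ j) T x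
      = L * ((inner ℂ x (Polynomial.aeval T p x)).re + (ρ - 1) * ((p.coeff 0).re * ‖x‖ ^ 2)) := by
  have hL : L ≠ 0 := by omega
  have hNL : N ≤ L := by omega
  have hpL : p.natDegree < L := by omega
  have h0 : ∑ j ∈ Finset.range L, p.eval (ζ ^ j) = L * p.coeff 0 := by
    simp_rw [Polynomial.eval_eq_sum_range' hpL]
    rw [Finset.sum_comm]
    rw [Finset.sum_eq_single 0]
    · simp
    · intro k hk hk0
      have := sum_root_pow_mul_conj_pow hζ hL (Finset.mem_range.1 hk) (Nat.pos_of_ne_zero hL)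
      simp only [pow_zero, mul_one, hk0, if_false] at this
      rw [← Finset.mul_sum, this, mul_zero]
    · simp [hL]
  have h1 : ∑ j ∈ Finset.range L, p.eval (ζ ^ j)
        * ∑ m ∈ Finset.range N, conj (ζ ^ j) ^ m * inner ℂ x ((T ^ m) x)
      = L * inner ℂ x (Polynomial.aeval T p x) := by
    rw [inner_aeval_of_pow_eq_zero hT p hNL hpL, Finset.mul_sum]
    simp_rw [Finset.mul_sum]
    rw [Finset.sum_comm]
    refine Finset.sum_congr rfl fun m hm => ?_
    have hm' : m < L := (Finset.mem_range.1 hm).trans_le hNL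
    simp_rw [Polynomial.eval_eq_sum_range' hpL, Finset.sum_mul]
    rw [Finset.sum_comm, Finset.sum_eq_single m]
    · have := sum_root_pow_mul_conj_pow hζ hL hm' hm'
      rw [if_pos rfl] at this
      rw [← this, Finset.sum_mul]
      exact Finset.sum_congr rfl fun j _ => by ring
    · intro k hk hkm
      have := sum_root_pow_mul_conj_pow hζ hL (Finset.mem_range.1 hk) hm'
      rw [if_neg hkm] at this
      calc _ = p.coeff k * inner ℂ x ((T ^ m) x)
            * ∑ j ∈ Finset.range L, (ζ ^ j) ^ k * conj (ζ ^ j) ^ m := by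
            rw [Finset.mul_sum]
            exact Finset.sum_congr rfl fun j _ => by ring
        _ = 0 := by rw [this, mul_zero]
    · intro h; exact absurd (Finset.mem_range.2 hm') h
  -- In the antianalytic part the exponents add, so only `k = m = 0` survives. The bound `N +
  -- p.natDegree < L` prevents a sum `k + m` from wrapping around modulo `L`.
  have h2 : ∑ j ∈ Finset.range L, conj (p.eval (ζ ^ j))
        * ∑ m ∈ Finset.range N, conj (ζ ^ j) ^ m * inner ℂ x ((T ^ m) x)
      = L * (conj (p.coeff 0) * (‖x‖ ^ 2 : ℝ)) := by
    have hx : inner ℂ x ((T ^ 0) x) = ((‖x‖ ^ 2 : ℝ) : ℂ) := by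
      rw [pow_zero, one_apply_eq_self, inner_self_eq_norm_sq_to_K]; norm_cast
    simp_rw [Finset.mul_sum]
    rw [Finset.sum_comm]
    simp_rw [Polynomial.eval_eq_sum_range, map_sum, Finset.sum_mul]
    have hkm : ∀ k ∈ Finset.range (p.natDegree + 1), ∀ m ∈ Finset.range N,
        ∑ j ∈ Finset.range L, conj (p.coeff k * (ζ ^ j) ^ k)
          * (conj (ζ ^ j) ^ m * inner ℂ x ((T ^ m) x))
        = if 0 = k + m then L * (conj (p.coeff k) * inner ℂ x ((T ^ m) x)) else 0 := by
      intro k hk m hm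
      have hk' := Finset.mem_range.1 hk
      have hm' := Finset.mem_range.1 hm
      have := sum_root_pow_mul_conj_pow hζ hL (Nat.pos_of_ne_zero hL)
        (show k + m < L by omega)
      calc _ = conj (p.coeff k) * inner ℂ x ((T ^ m) x)
            * ∑ j ∈ Finset.range L, (ζ ^ j) ^ 0 * conj (ζ ^ j) ^ (k + m) := by
            rw [Finset.mul_sum]
            refine Finset.sum_congr rfl fun j _ => ?_
            rw [map_mul, map_pow (starRingEnd ℂ) (ζ ^ j), pow_add, pow_zero]
            ring
        _ = _ := by
            rw [this]
            split_ifs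
            · ring
            · rw [mul_zero]
    rw [Finset.sum_eq_single 0]
    · rw [Finset.sum_comm, Finset.sum_eq_single 0]
      · rw [hkm 0 (by simp) 0 (by simpa using hN), if_pos rfl, hx]
      · intro k hk hk0
        rw [hkm k hk 0 (by simpa using hN), if_neg (by omega)]
      · simp
    · intro m hm hm0
      rw [Finset.sum_comm]
      refine Finset.sum_eq_zero fun k hk => ?_
      rw [hkm k hk m hm, if_neg (by omega)]
    · simp; omega
  -- `2 Re a Re b = Re (a b) + Re (ā b)` splits the average into `h1` and `h2`; the latter raises `ρ
  -- - 2` to `ρ - 1`.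
  have hterm : ∀ a b : ℂ, a.re * ((ρ - 2) * ‖x‖ ^ 2 + 2 * b.re)
      = (ρ - 2) * ‖x‖ ^ 2 * a.re + (a * b).re + (conj a * b).re := by
    intro a b
    simp only [Complex.mul_re, Complex.conj_re, Complex.conj_im]
    ring
  have e0 := congrArg Complex.re h0
  have e1 := congrArg Complex.re h1
  have e2 := congrArg Complex.re h2
  rw [← mul_assoc, Complex.re_mul_ofReal] at e2
  rw [← Complex.ofReal_natCast, Complex.re_ofReal_mul, Complex.re_sum] at e0 e1 e2
  rw [Complex.conj_re] at e2
  simp_rw [kernelForm, hterm, Finset.sum_add_distrib, ← Finset.mul_sum]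
  rw [e0, e1, e2]
  ring

variable [CompleteSpace H]

lemma re_inner_rePart (A : H →L[ℂ] H) (x : H) :
    (inner ℂ x (rePart A x)).re = (inner ℂ x (A x)).re := by
  have h : (inner ℂ (A x) x).re = (inner ℂ x (A x)).re := by
    rw [← inner_conj_symm x (A x), Complex.conj_re]
  simp only [rePart, smul_add, add_apply, smul_apply,
    inner_add_right, inner_smul_right, ContinuousLinearMap.adjoint_inner_right, Complex.add_re]
  norm_num [h]
  ring

lemma isSelfAdjoint_rePart (A : H →L[ℂ] H) : IsSelfAdjoint (rePart A) := by
  rw [IsSelfAdjoint, rePart, star_smul, star_add, ContinuousLinearMap.star_eq_adjoint,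
    ContinuousLinearMap.star_eq_adjoint, ContinuousLinearMap.adjoint_adjoint, add_comm]
  norm_num

lemma isSelfAdjoint_ofReal_smul {A : H →L[ℂ] H} (hA : IsSelfAdjoint A) (c : ℝ) :
    IsSelfAdjoint ((c : ℂ) • A) := by
  rw [IsSelfAdjoint, star_smul, hA.star_eq]
  simp

lemma isPositive_iff_re_inner {A : H →L[ℂ] H} (hA : IsSelfAdjoint A) :
    A.IsPositive ↔ ∀ x, 0 ≤ (inner ℂ x (A x)).re := by
  rw [ContinuousLinearMap.isPositive_def']
  refine ⟨fun h x => ?_, fun h => ⟨hA, fun x => ?_⟩⟩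
  · have := h.2 x
    rwa [ContinuousLinearMap.reApplyInnerSelf_apply, ← inner_conj_symm] at this
  · rw [ContinuousLinearMap.reApplyInnerSelf_apply, ← inner_conj_symm]
    exact h x

lemma harnack_isPositive_iff (ρ c : ℝ) (T₁ T₀ : H →L[ℂ] H) (p : Polynomial ℂ) :
    (((c ^ 2 : ℝ) : ℂ) • rePart (Polynomial.aeval T₀ p)
      + (((c ^ 2 - 1) * (ρ - 1) : ℝ) : ℂ) • rePart (Polynomial.aeval (0 : H →L[ℂ] H) p)
      - rePart (Polynomial.aeval T₁ p)).IsPositive ↔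
    ∀ x : H, (inner ℂ x (Polynomial.aeval T₁ p x)).re ≤
      c ^ 2 * (inner ℂ x (Polynomial.aeval T₀ p x)).re
        + (c ^ 2 - 1) * (ρ - 1) * ((p.coeff 0).re * ‖x‖ ^ 2) := by
  rw [isPositive_iff_re_inner]
  · refine forall_congr' fun x => ?_
    rw [sub_apply, add_apply, inner_sub_right,
      inner_add_right, smul_apply, smul_apply,
      inner_smul_right, inner_smul_right, Complex.sub_re, Complex.add_re, Complex.re_ofReal_mul,
      Complex.re_ofReal_mul, re_inner_rePart, re_inner_rePart, re_inner_rePart, aeval_zero_eq,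
      re_inner_smul_one, sub_nonneg]
  · exact ((isSelfAdjoint_ofReal_smul (isSelfAdjoint_rePart _) _).add
      (isSelfAdjoint_ofReal_smul (isSelfAdjoint_rePart _) _)).sub (isSelfAdjoint_rePart _)

lemma inverse_one_sub_of_pow_eq_zero {R : Type*} [Ring R] {a : R} {N : ℕ} (h : a ^ N = 0) :
    Ring.inverse (1 - a) = ∑ m ∈ Finset.range N, a ^ m := by
  let w : Rˣ := ⟨1 - a, ∑ m ∈ Finset.range N, a ^ m, by rw [mul_neg_geom_sum, h, sub_zero],
    by rw [geom_sum_mul_neg, h, sub_zero]⟩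
  exact Ring.inverse_unit w

lemma rhoKernel_eq_sum (ρ : ℝ) {N : ℕ} (z : ℂ) {T : H →L[ℂ] H} (hT : T ^ N = 0) :
    rhoKernel ρ z T = ∑ m ∈ Finset.range N, conj z ^ m • T ^ m
      + ∑ m ∈ Finset.range N, z ^ m • ContinuousLinearMap.adjoint (T ^ m)
      + ((ρ - 2 : ℝ) : ℂ) • (1 : H →L[ℂ] H) := by
  have hs : ∀ m, (ContinuousLinearMap.adjoint T) ^ m = ContinuousLinearMap.adjoint (T ^ m) := by
    intro m
    rw [← ContinuousLinearMap.star_eq_adjoint, ← ContinuousLinearMap.star_eq_adjoint, star_pow]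
  rw [rhoKernel, inverse_one_sub_of_pow_eq_zero (N := N), inverse_one_sub_of_pow_eq_zero (N := N)]
  · simp only [smul_pow, hs]
  · rw [smul_pow, hs, hT, map_zero, smul_zero]
  · rw [smul_pow, hT, smul_zero]

/-- The full series has real part equal to the Poisson kernel `(1 - |w|²) / |1 - w|²`. After
multiplication by `|1 - w|²` the truncation error is at most `4 r ^ M`, which is below `1 - r²` for
large `M`. -/
lemma exists_re_geom_sum_nonneg {r : ℝ} (hr0 : 0 ≤ r) (hr : r < 1) (N : ℕ) :
    ∃ M, N ≤ M ∧ ∀ w : ℂ, ‖w‖ ≤ r → 0 ≤ (2 * ∑ m ∈ Finset.range M, w ^ m - 1).re := by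
  have h1 : 0 < (1 - r ^ 2) / 4 := by nlinarith
  obtain ⟨M₀, hM₀⟩ := exists_pow_lt_of_lt_one h1 hr
  refine ⟨max N M₀, le_max_left _ _, fun w hw => ?_⟩
  set M := max N M₀
  have hM : r ^ M ≤ (1 - r ^ 2) / 4 :=
    (pow_le_pow_of_le_one hr0 hr.le (le_max_right _ _)).trans hM₀.le
  have hw1 : ‖w‖ < 1 := hw.trans_lt hr
  have hne : 1 - w ≠ 0 := by
    intro h
    rw [sub_eq_zero] at h
    rw [← h] at hw1
    simp at hw1
  set s := ∑ m ∈ Finset.range M, w ^ m with hs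
  have hg : s * (1 - w) = 1 - w ^ M := geom_sum_mul_neg w M
  have hpos : 0 < Complex.normSq (1 - w) := Complex.normSq_pos.2 hne
  have key : (2 * s - 1) * (Complex.normSq (1 - w) : ℂ)
      = ((1 - Complex.normSq w : ℝ) : ℂ) + (w - conj w) - 2 * (w ^ M * (1 - conj w)) := by
    have h2 : (Complex.normSq (1 - w) : ℂ) = (1 - w) * (1 - conj w) := by
      rw [← Complex.mul_conj]; simp
    have h3 : (Complex.normSq w : ℂ) = w * conj w := by rw [← Complex.mul_conj]
    rw [h2]
    push_cast
    rw [h3]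
    linear_combination 2 * (1 - conj w) * hg
  have hre := congrArg Complex.re key
  rw [Complex.re_mul_ofReal] at hre
  have hb : (2 * (w ^ M * (1 - conj w))).re ≤ 4 * r ^ M := by
    refine (Complex.re_le_norm _).trans ?_
    rw [norm_mul, norm_mul, norm_pow]
    have h4 : ‖1 - conj w‖ ≤ 2 := by
      refine (norm_sub_le _ _).trans ?_
      rw [RCLike.norm_conj, norm_one]; linarith
    have h5 : ‖w‖ ^ M ≤ r ^ M := pow_le_pow_left₀ (norm_nonneg _) hw M
    have h6 : ‖w‖ ^ M * ‖1 - conj w‖ ≤ r ^ M * 2 :=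
      mul_le_mul h5 h4 (norm_nonneg _) (pow_nonneg hr0 M)
    rw [Complex.norm_ofNat]
    linarith
  have hn : Complex.normSq w ≤ r ^ 2 := by
    rw [Complex.normSq_eq_norm_sq]
    exact pow_le_pow_left₀ (norm_nonneg _) hw 2
  have hfin : 0 ≤ (2 * s - 1).re * Complex.normSq (1 - w) := by
    rw [hre]
    simp only [Complex.sub_re, Complex.add_re, Complex.ofReal_re, Complex.conj_re, sub_self,
      add_zero]
    linarith
  exact nonneg_of_mul_nonneg_left hfin hpos

/-- Domination is tested on a truncated Poisson kernel at radius `r < 1`. Truncation beyond degree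
`N` is invisible to operators with `T ^ N = 0`, so the test yields the kernel form with `r z` in
place of `z`; then `r → 1`. -/
lemma HarnackDominated.exists_kernelForm_le {ρ : ℝ} {N : ℕ} {T₁ T₀ : H →L[ℂ] H}
    (h : HarnackDominated ρ T₁ T₀) (hT₁ : T₁ ^ N = 0) (hT₀ : T₀ ^ N = 0) :
    ∃ c : ℝ, ∀ z : ℂ, ‖z‖ = 1 → ∀ x : H,
      kernelForm ρ N z T₁ x ≤ c ^ 2 * kernelForm ρ N z T₀ x := by
  obtain ⟨-, -, c, -, hc⟩ := h
  refine ⟨c, fun z hz x => ?_⟩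
  let F : (H →L[ℂ] H) → ℝ → ℝ := fun T r =>
    (ρ - 2) * ‖x‖ ^ 2
      + 2 * (∑ m ∈ Finset.range N, ((r : ℂ) ^ m * conj z ^ m) * inner ℂ x ((T ^ m) x)).re
  have hF : ∀ T, Continuous (F T) := by
    intro T
    refine continuous_const.add (continuous_const.mul (Complex.continuous_re.comp ?_))
    fun_prop
  have hF1 : ∀ T, F T 1 = kernelForm ρ N z T x := by
    intro T; simp [F, kernelForm]
  have hlt : ∀ r ∈ Set.Ico (0 : ℝ) 1, F T₁ r ≤ c ^ 2 * F T₀ r := by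
    rintro r ⟨hr0, hr1⟩
    -- `N + 1` rather than `N` keeps `M` positive, so that `2 q - 1` has constant coefficient `1`.
    obtain ⟨M, hNM, hM⟩ := exists_re_geom_sum_nonneg hr0 hr1 (N + 1)
    let q : Polynomial ℂ := ∑ m ∈ Finset.range M, Polynomial.monomial m ((r : ℂ) ^ m * conj z ^ m)
    have hqc : ∀ m < M, q.coeff m = (r : ℂ) ^ m * conj z ^ m := by
      intro m hm
      simp only [q, Polynomial.finsetSum_coeff, Polynomial.coeff_monomial]
      simp [hm]
    have hqdeg : q.natDegree < M := by
      refine lt_of_le_of_lt (Polynomial.natDegree_sum_le_of_forall_le _ _ (n := M - 1) ?_) (by omega)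
      intro m hm
      have := Finset.mem_range.1 hm
      exact (Polynomial.natDegree_monomial_le _).trans (by omega)
    have hin : ∀ T : H →L[ℂ] H, T ^ N = 0 →
        (inner ℂ x (Polynomial.aeval T (2 * q - 1) x)).re + (ρ - 1) * ‖x‖ ^ 2 = F T r := by
      intro T hT
      have h1 : inner ℂ x (Polynomial.aeval T (2 * q - 1) x)
          = 2 * inner ℂ x (Polynomial.aeval T q x) - (‖x‖ ^ 2 : ℝ) := by
        have : Polynomial.aeval T (2 * q - 1) = (2 : ℂ) • Polynomial.aeval T q - 1 := by
          rw [map_sub, map_mul, map_one, map_ofNat, ofNat_smul_eq_nsmul, nsmul_eq_mul]; simp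
        rw [this, sub_apply, inner_sub_right, smul_apply,
          inner_smul_right, one_apply_eq_self, inner_self_eq_norm_sq_to_K]
        norm_cast
      rw [h1, inner_aeval_of_pow_eq_zero hT q (by omega) hqdeg, Complex.sub_re, Complex.ofReal_re]
      have h2 : ∑ m ∈ Finset.range N, q.coeff m * inner ℂ x ((T ^ m) x)
          = ∑ m ∈ Finset.range N, ((r : ℂ) ^ m * conj z ^ m) * inner ℂ x ((T ^ m) x) :=
        Finset.sum_congr rfl fun m hm => by
          rw [hqc m (by have := Finset.mem_range.1 hm; omega)]
      rw [h2]
      simp only [F, Complex.mul_re, Complex.re_ofNat, Complex.im_ofNat]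
      ring
    have hpos : ∀ w : ℂ, ‖w‖ ≤ 1 → 0 ≤ ((2 * q - 1).eval w).re := by
      intro w hw
      have : (2 * q - 1).eval w
          = 2 * ∑ m ∈ Finset.range M, ((r : ℂ) * conj z * w) ^ m - 1 := by
        simp only [q, Polynomial.eval_sub, Polynomial.eval_mul, Polynomial.eval_ofNat,
          Polynomial.eval_one, Polynomial.eval_finsetSum, Polynomial.eval_monomial, mul_pow]
      rw [this]
      apply hM
      rw [norm_mul, norm_mul, RCLike.norm_conj, hz, Complex.norm_real, Real.norm_of_nonneg hr0]
      nlinarith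
    have h3 := (harnack_isPositive_iff ρ c T₁ T₀ _).1 (hc _ hpos) x
    have h4 : (2 * q - 1).coeff 0 = 1 := by
      rw [Polynomial.coeff_sub, Polynomial.coeff_one_zero, Polynomial.coeff_ofNat_mul,
        hqc 0 (by omega)]
      norm_num
    rw [h4, Complex.one_re] at h3
    -- Adding `(ρ - 1) ‖x‖²` to both sides of `h3` turns the correction `(c² - 1)(ρ - 1)` into `c²
    -- (ρ - 1)`, which is what `c² F T₀ r` contains.
    have h5 := hin T₁ hT₁
    have h6 := hin T₀ hT₀
    rw [← h5, ← h6]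
    nlinarith
  have hcl : (1 : ℝ) ∈ closure (Set.Ico (0 : ℝ) 1) := by
    rw [closure_Ico zero_ne_one]; simp
  have := (isClosed_le (hF T₁) (continuous_const.mul (hF T₀))).closure_subset_iff.2 hlt hcl
  simpa [hF1] using this

/-- The values `Re p(ζ ^ j)` are nonnegative weights, so the pointwise inequality survives averaging
over the roots of unity. -/
lemma harnackDominated_of_kernelForm_le {ρ c : ℝ} (hc : 1 ≤ c) {N : ℕ} (hN : 0 < N)
    {T₁ T₀ : H →L[ℂ] H} (hC₁ : IsRhoContraction ρ T₁) (hC₀ : IsRhoContraction ρ T₀)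
    (hT₁ : T₁ ^ N = 0) (hT₀ : T₀ ^ N = 0)
    (h : ∀ z : ℂ, ‖z‖ = 1 → ∀ x : H, kernelForm ρ N z T₁ x ≤ c ^ 2 * kernelForm ρ N z T₀ x) :
    HarnackDominated ρ T₁ T₀ := by
  refine ⟨hC₁, hC₀, c, hc, fun p hp => (harnack_isPositive_iff ρ c T₁ T₀ p).2 fun x => ?_⟩
  set L := N + p.natDegree + 1 with hL
  have hζ := Complex.isPrimitiveRoot_exp L (by omega)
  set ζ := Complex.exp (2 * Real.pi * Complex.I / L)
  have hn : ‖ζ‖ = 1 := Complex.norm_eq_one_of_pow_eq_one hζ.pow_eq_one (by omega)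
  have h1 := sum_re_eval_mul_kernelForm ρ hN hT₁ p (by omega) hζ x
  have h0 := sum_re_eval_mul_kernelForm ρ hN hT₀ p (by omega) hζ x
  have hle : ∑ j ∈ Finset.range L, (p.eval (ζ ^ j)).re * kernelForm ρ N (ζ ^ j) T₁ x
      ≤ c ^ 2 * ∑ j ∈ Finset.range L, (p.eval (ζ ^ j)).re * kernelForm ρ N (ζ ^ j) T₀ x := by
    rw [Finset.mul_sum]
    refine Finset.sum_le_sum fun j _ => ?_
    have hj : ‖ζ ^ j‖ = 1 := by rw [norm_pow, hn, one_pow]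
    have := mul_le_mul_of_nonneg_left (h _ hj x) (hp _ hj.le)
    linarith
  rw [h1, h0] at hle
  have hLpos : (0 : ℝ) < L := by positivity
  have := le_of_mul_le_mul_left (hle.trans_eq (by ring :
    _ = (L : ℝ) * (c ^ 2 * ((inner ℂ x (Polynomial.aeval T₀ p x)).re
      + (ρ - 1) * ((p.coeff 0).re * ‖x‖ ^ 2))))) hLpos
  linarith

lemma adjoint_mul_mul_pow {V : H →L[ℂ] H} (hV : V ∈ unitary (H →L[ℂ] H)) (T : H →L[ℂ] H) (m : ℕ) :
    (star V * T * V) ^ m = star V * T ^ m * V := by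
  have h : V * star V = 1 := (Unitary.mem_iff.1 hV).2
  induction m with
  | zero => simp [(Unitary.mem_iff.1 hV).1]
  | succ m ih =>
    rw [pow_succ, ih, pow_succ]
    calc star V * T ^ m * V * (star V * T * V) = star V * T ^ m * (V * star V) * T * V := by
          simp only [mul_assoc]
      _ = _ := by rw [h, mul_one]; simp only [mul_assoc]

lemma inner_star_mul_mul_pow {V : H →L[ℂ] H} (hV : V ∈ unitary (H →L[ℂ] H)) (T : H →L[ℂ] H)
    (m : ℕ) (x y : H) :
    inner ℂ x (((star V * T * V) ^ m) y) = inner ℂ (V x) ((T ^ m) (V y)) := by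
  rw [adjoint_mul_mul_pow hV, mul_assoc, ContinuousLinearMap.star_eq_adjoint]
  exact ContinuousLinearMap.adjoint_inner_right V x ((T ^ m) (V y))

lemma norm_apply_of_mem_unitary {V : H →L[ℂ] H} (hV : V ∈ unitary (H →L[ℂ] H)) (x : H) :
    ‖V x‖ = ‖x‖ :=
  ContinuousLinearMap.norm_map_of_mem_unitary hV x

lemma kernelForm_eq_re_inner (ρ : ℝ) {N : ℕ} (z : ℂ) {T : H →L[ℂ] H} (hT : T ^ N = 0) (x : H) :
    kernelForm ρ N z T x = (inner ℂ x (rhoKernel ρ z T x)).re := by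
  have h : ∀ m, (inner ℂ x ((z ^ m • ContinuousLinearMap.adjoint (T ^ m)) x)).re
      = (conj z ^ m * inner ℂ x ((T ^ m) x)).re := by
    intro m
    rw [smul_apply, inner_smul_right, ContinuousLinearMap.adjoint_inner_right,
      ← Complex.conj_re, map_mul, inner_conj_symm, map_pow]
  rw [rhoKernel_eq_sum ρ z hT, add_apply, add_apply, inner_add_right, inner_add_right,
    Complex.add_re, Complex.add_re, re_inner_smul_one, sum_apply, sum_apply, inner_sum, inner_sum,
    Complex.re_sum, Complex.re_sum, Finset.sum_congr rfl fun m _ => h m, kernelForm,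
    Complex.re_sum, Complex.ofReal_re]
  simp only [smul_apply, inner_smul_right]
  ring

lemma kernelForm_star_mul_mul (ρ : ℝ) (N : ℕ) (z : ℂ) {V : H →L[ℂ] H}
    (hV : V ∈ unitary (H →L[ℂ] H)) (T : H →L[ℂ] H) (x : H) :
    kernelForm ρ N z (star V * T * V) x = kernelForm ρ N z T (V x) := by
  simp only [kernelForm, inner_star_mul_mul_pow hV, norm_apply_of_mem_unitary hV]

lemma IsRhoContraction.star_mul_mul {ρ : ℝ} {T : H →L[ℂ] H} (hT : IsRhoContraction ρ T)
    {V : H →L[ℂ] H} (hV : V ∈ unitary (H →L[ℂ] H)) : IsRhoContraction ρ (star V * T * V) := by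
  obtain ⟨K, i1, i2, i3, J, W, hW, h⟩ := hT
  -- The unitary dilation is unchanged; only the embedding is precomposed with `V`.
  refine ⟨K, i1, i2, i3, J.comp ⟨V.toLinearMap, norm_apply_of_mem_unitary hV⟩, W, hW,
    fun m hm => ?_⟩
  ext y
  refine ext_inner_left ℂ fun x => ?_
  rw [inner_star_mul_mul_pow hV, h m hm]
  simp only [smul_apply, ContinuousLinearMap.comp_apply, inner_smul_right,
    ContinuousLinearMap.adjoint_inner_right]
  rfl

end General

/-! ### The truncated shift and its Toeplitz kernel matrix. -/

section Shift

lemma truncShift_pow_apply (m : ℕ) (b : ℂ) (k : ℕ) (i j : Fin m) :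
    (truncShift m b ^ k) i j = if (i : ℕ) + k = j then b ^ k else 0 := by
  induction k generalizing j with
  | zero => simp [Matrix.one_apply, Fin.ext_iff]
  | succ k ih =>
    rw [pow_succ, Matrix.mul_apply]
    simp_rw [ih, truncShift, Matrix.of_apply]
    split_ifs with h
    · have hlt : (i : ℕ) + k < m := by have := j.2; omega
      rw [Finset.sum_eq_single (⟨i + k, hlt⟩ : Fin m)]
      · rw [if_pos rfl, if_pos (by simp only []; omega), pow_succ]
      · intro l _ hl
        rw [if_neg, zero_mul]
        intro h'
        exact hl (Fin.ext h'.symm)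
      · simp
    · refine Finset.sum_eq_zero fun l _ => ?_
      split_ifs
      · omega
      all_goals simp

lemma truncShift_pow_self (m : ℕ) (b : ℂ) : truncShift m b ^ m = 0 := by
  ext i j
  rw [truncShift_pow_apply, if_neg (by have := j.2; omega)]
  rfl

lemma toOp_pow {m : ℕ} (A : Matrix (Fin m) (Fin m) ℂ) (k : ℕ) : toOp A ^ k = toOp (A ^ k) :=
  (map_pow _ A k).symm

lemma toOp_truncShift_pow_self (m : ℕ) (b : ℂ) : toOp (truncShift m b) ^ m = 0 := by
  rw [toOp_pow, truncShift_pow_self, toOp, map_zero]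

lemma toOp_apply {m : ℕ} (A : Matrix (Fin m) (Fin m) ℂ) (x : EuclideanSpace ℂ (Fin m))
    (i : Fin m) : toOp A x i = ∑ j, A i j * x j := rfl

lemma inner_toOp {m : ℕ} (A : Matrix (Fin m) (Fin m) ℂ) (x y : EuclideanSpace ℂ (Fin m)) :
    inner ℂ x (toOp A y) = ∑ i, ∑ j, conj (x i) * y j * A i j := by
  rw [PiLp.inner_apply]
  refine Finset.sum_congr rfl fun i _ => ?_
  rw [RCLike.inner_apply', toOp_apply, Finset.mul_sum]
  exact Finset.sum_congr rfl fun j _ => by ring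

lemma inner_single_toOp_single {m : ℕ} (A : Matrix (Fin m) (Fin m) ℂ) (i j : Fin m) :
    inner ℂ (EuclideanSpace.single i (1 : ℂ)) (toOp A (EuclideanSpace.single j (1 : ℂ)))
      = A i j := by
  rw [EuclideanSpace.inner_single_left, toOp_apply]
  simp

/-- The Toeplitz matrix `K_1^ρ(S_m(b))`: `ρ` on the diagonal and `b ^ |i - j|` off it. -/
def kernelMatrix (ρ : ℝ) (m : ℕ) (b : ℝ) : Matrix (Fin m) (Fin m) ℂ :=
  Matrix.of fun i j => if i = j then (ρ : ℂ) else (b : ℂ) ^ ((i - j : ℕ) + (j - i : ℕ))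

lemma kernelMatrix_conj (ρ : ℝ) (m : ℕ) (b : ℝ) (i j : Fin m) :
    conj (kernelMatrix ρ m b i j) = kernelMatrix ρ m b j i := by
  simp only [kernelMatrix, Matrix.of_apply, eq_comm (a := j), add_comm (j - i : ℕ)]
  split_ifs <;> simp

lemma isSelfAdjoint_toOp_kernelMatrix (ρ : ℝ) (m : ℕ) (b : ℝ) :
    IsSelfAdjoint (toOp (kernelMatrix ρ m b)) := by
  rw [IsSelfAdjoint, toOp, ← map_star]
  congr 1
  ext i j
  exact kernelMatrix_conj ρ m b j i

/-- In `b` times row `k + 1` minus row `k`, all entries to the right of column `k + 1` cancel, and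
the entry in that column is `b (ρ - 1) ≠ 0`. Each coordinate of a null vector is thus determined by
the earlier ones. -/
lemma kernelMatrix_mulVec_eq_zero {ρ b : ℝ} (hρ : ρ ≠ 1) (hb : b ≠ 0) {n : ℕ}
    {v : Fin (n + 1) → ℂ} (hv : (kernelMatrix ρ (n + 1) b).mulVec v = 0) (h0 : v 0 = 0) :
    v = 0 := by
  have hrow : ∀ i, ∑ j, kernelMatrix ρ (n + 1) b i j * v j = 0 := fun i => congrFun hv i
  have hall : ∀ k (hk : k < n + 1), v ⟨k, hk⟩ = 0 := by
    intro k
    induction k using Nat.strong_induction_on with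
    | _ k ih =>
      intro hk
      rcases k with _ | k
      · exact h0
      · have h1 := hrow ⟨k + 1, hk⟩
        have h2 := hrow ⟨k, by omega⟩
        have h3 : ∑ j, ((b : ℂ) * kernelMatrix ρ (n + 1) b ⟨k + 1, hk⟩ j
            - kernelMatrix ρ (n + 1) b ⟨k, by omega⟩ j) * v j = 0 := by
          simp_rw [sub_mul, mul_assoc]
          rw [Finset.sum_sub_distrib, ← Finset.mul_sum, h1, h2]
          simp
        rw [Finset.sum_eq_single (⟨k + 1, hk⟩ : Fin (n + 1))] at h3
        · simp only [kernelMatrix, Matrix.of_apply, if_true, Fin.mk.injEq] at h3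
          rw [if_neg (by omega), mul_eq_zero] at h3
          refine h3.resolve_left ?_
          have : k - (k + 1) + (k + 1 - k) = 1 := by omega
          rw [this, pow_one, show (b : ℂ) * ρ - b = b * ((ρ : ℂ) - 1) by ring]
          refine mul_ne_zero (by exact_mod_cast hb) (sub_ne_zero.2 (by exact_mod_cast hρ))
        · intro j _ hj
          rcases lt_trichotomy (j : ℕ) (k + 1) with h | h | h
          · rw [ih j h j.2, mul_zero]
          · exact absurd (Fin.ext h) hj
          · have e1 : (⟨k + 1, hk⟩ : Fin (n + 1)) ≠ j := fun e => hj e.symm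
            have e2 : (⟨k, by omega⟩ : Fin (n + 1)) ≠ j := fun e => by
              have := congrArg Fin.val e; simp at this; omega
            simp only [kernelMatrix, Matrix.of_apply, if_neg e1, if_neg e2]
            rw [← pow_succ', show k + 1 - (j : ℕ) + (j - (k + 1)) + 1 = k - j + (j - k) by omega,
              sub_self, zero_mul]
        · simp
  ext ⟨k, hk⟩
  exact hall k hk

lemma kernelMatrix_rev (ρ : ℝ) (m : ℕ) (b : ℝ) (i j : Fin m) :
    kernelMatrix ρ m b i.rev j.rev = kernelMatrix ρ m b i j := by
  simp only [kernelMatrix, Matrix.of_apply, Fin.rev_inj, Fin.val_rev]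
  congr 2
  omega

/-- Reversing the basis leaves the symmetric Toeplitz matrix unchanged and exchanges the first and
last coordinates. -/
lemma kernelMatrix_mulVec_eq_zero_of_last {ρ b : ℝ} (hρ : ρ ≠ 1) (hb : b ≠ 0) {n : ℕ}
    {v : Fin (n + 1) → ℂ} (hv : (kernelMatrix ρ (n + 1) b).mulVec v = 0)
    (h0 : v (Fin.last n) = 0) : v = 0 := by
  have h1 : v ∘ Fin.rev = 0 := by
    refine kernelMatrix_mulVec_eq_zero hρ hb (n := n) ?_ (by simpa using h0)
    ext i
    have := congrFun hv i.rev
    simp only [Matrix.mulVec, dotProduct, Pi.zero_apply] at this ⊢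
    rw [← this]
    refine (Fintype.sum_equiv Fin.revPerm _ _ fun j => ?_)
    simp only [Fin.revPerm_apply, kernelMatrix_rev, Function.comp]
  ext i
  have := congrFun h1 i.rev
  simpa using this

/-- Conjugation by `diag(z ^ k)` multiplies the shift by `z̄`, so every kernel on the circle is a
rotated copy of the one at `z = 1`. -/
lemma rhoKernel_truncShift (ρ : ℝ) (m : ℕ) (b : ℝ) {z : ℂ} (hz : ‖z‖ = 1) :
    rhoKernel ρ z (toOp (truncShift m b))
      = toOp (Matrix.diagonal (fun k : Fin m => z ^ (k : ℕ)) * kernelMatrix ρ m b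
          * Matrix.diagonal (fun k : Fin m => conj z ^ (k : ℕ))) := by
  have hc : z * conj z = 1 := by rw [Complex.mul_conj, Complex.normSq_eq_norm_sq, hz]; simp
  rw [rhoKernel_eq_sum ρ z (toOp_truncShift_pow_self m b)]
  have hadj : ∀ A : Matrix (Fin m) (Fin m) ℂ, ContinuousLinearMap.adjoint (toOp A)
      = toOp A.conjTranspose := fun A => (map_star Matrix.toEuclideanCLM A).symm
  have hone : (1 : EuclideanSpace ℂ (Fin m) →L[ℂ] EuclideanSpace ℂ (Fin m)) = toOp 1 :=
    (map_one Matrix.toEuclideanCLM).symm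
  have hsmul : ∀ (c : ℂ) (A : Matrix (Fin m) (Fin m) ℂ), c • toOp A = toOp (c • A) :=
    fun c A => (map_smul Matrix.toEuclideanCLM c A).symm
  have hadd : ∀ A B : Matrix (Fin m) (Fin m) ℂ, toOp A + toOp B = toOp (A + B) :=
    fun A B => (map_add Matrix.toEuclideanCLM A B).symm
  have hsum : ∀ f : ℕ → Matrix (Fin m) (Fin m) ℂ, ∑ k ∈ Finset.range m, toOp (f k)
      = toOp (∑ k ∈ Finset.range m, f k) := fun f => (map_sum Matrix.toEuclideanCLM f _).symm
  simp_rw [toOp_pow, hadj, hone, hsmul, hsum, hadd]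
  congr 1
  have hup : ∀ (c : ℂ) (i j : Fin m),
      ∑ k ∈ Finset.range m, c ^ k * (if (i : ℕ) + k = j then (b : ℂ) ^ k else 0)
        = if (i : ℕ) ≤ j then (c * b) ^ (j - i : ℕ) else 0 := by
    intro c i j
    split_ifs with h
    · rw [Finset.sum_eq_single (j - i : ℕ)]
      · rw [if_pos (by omega), mul_pow]
      · intro k _ hk
        rw [if_neg (by omega), mul_zero]
      · intro hk
        have := j.2
        exact absurd (Finset.mem_range.2 (by omega)) hk
    · refine Finset.sum_eq_zero fun k _ => ?_
      rw [if_neg (by omega), mul_zero]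
  ext i j
  rw [Matrix.mul_diagonal, Matrix.diagonal_mul]
  simp only [Matrix.add_apply, Matrix.sum_apply, Matrix.smul_apply, smul_eq_mul,
    Matrix.conjTranspose_apply, truncShift_pow_apply, Matrix.one_apply]
  have hst : ∀ k : ℕ, star (if (j : ℕ) + k = i then (b : ℂ) ^ k else 0)
      = if (j : ℕ) + k = i then (b : ℂ) ^ k else 0 := by
    intro k; split_ifs <;> simp
  simp_rw [hst, hup]
  have hpow : ∀ k : ℕ, z ^ k * conj z ^ k = 1 := fun k => by rw [← mul_pow, hc, one_pow]
  simp only [kernelMatrix, Matrix.of_apply]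
  rcases lt_trichotomy (i : ℕ) j with h | h | h
  · rw [if_pos h.le, if_neg (by omega), if_neg (fun e => by rw [e] at h; omega),
      if_neg (fun e => by rw [e] at h; omega)]
    obtain ⟨k, hk⟩ := Nat.exists_eq_add_of_le h.le
    rw [hk, show (i : ℕ) + k - i = k by omega, show (i : ℕ) - (i + k) + k = k by omega, pow_add,
      mul_pow]
    linear_combination (-(conj z ^ k) * (b : ℂ) ^ k) * hpow i
  · have hij : i = j := Fin.ext h
    subst hij
    simp only [le_refl, if_true, Nat.sub_self, pow_zero]
    push_cast
    linear_combination (-(ρ : ℂ)) * hpow i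
  · rw [if_neg (by omega), if_pos h.le, if_neg (fun e => by rw [e] at h; omega),
      if_neg (fun e => by rw [e] at h; omega)]
    obtain ⟨k, hk⟩ := Nat.exists_eq_add_of_le h.le
    rw [hk, show (j : ℕ) + k - j = k by omega, show k + (j - (j + k) : ℕ) = k by omega, pow_add,
      mul_pow]
    linear_combination (-(z ^ k) * (b : ℂ) ^ k) * hpow j

end Shift

/-! ### Unitary `ρ`-dilations of the truncated shift and positivity of the kernel matrix. -/

section Dilation

open scoped lp ENNReal

variable {E : Type u} [NormedAddCommGroup E] 
lemma memℓp_shift (s : ℤ) (f : lp (fun _ : ℤ => E) 2) : Memℓp (fun k => f (k + s)) 2 := by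
  have h2 : 0 < (2 : ℝ≥0∞).toReal := by norm_num
  exact memℓp_gen ((Equiv.addRight s).summable_iff.2 ((memℓp_gen_iff h2).1 (lp.memℓp f)))

variable [InnerProductSpace ℂ E]

/-- Translation by `s` on `ℓ²(ℤ; E)`. -/
def shiftLinear (s : ℤ) : lp (fun _ : ℤ => E) 2 →ₗ[ℂ] lp (fun _ : ℤ => E) 2 where
  toFun f := ⟨fun k => f (k + s), memℓp_shift s f⟩
  map_add' _ _ := rfl
  map_smul' _ _ := rfl

lemma shiftLinear_apply (s : ℤ) (f : lp (fun _ : ℤ => E) 2) (k : ℤ) :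
    shiftLinear s f k = f (k + s) := rfl

/-- The bilateral backward shift on `ℓ²(ℤ; E)`. -/
def bilateralShift : lp (fun _ : ℤ => E) 2 ≃ₗᵢ[ℂ] lp (fun _ : ℤ => E) 2 where
  toLinearEquiv := LinearEquiv.ofLinearMap (shiftLinear 1) (shiftLinear (-1))
    (by ext f k; simp [shiftLinear_apply]) (by ext f k; simp [shiftLinear_apply])
  norm_map' f := by
    have h2 : 0 < (2 : ℝ≥0∞).toReal := by norm_num
    rw [lp.norm_eq_tsum_rpow h2, lp.norm_eq_tsum_rpow h2]
    congr 1
    exact (Equiv.addRight (1 : ℤ)).tsum_eq fun k => ‖f k‖ ^ (2 : ℝ≥0∞).toReal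

/-- The operator `x ↦ ∑ k, x k • δ_k ⊗ u k` into `ℓ²(ℤ; E)`. -/
def diagEmbedding {m : ℕ} (u : Fin m → E) :
    EuclideanSpace ℂ (Fin m) →ₗ[ℂ] lp (fun _ : ℤ => E) 2 where
  toFun x := ∑ k : Fin m, lp.single 2 (k : ℤ) (x k • u k)
  map_add' x y := by
    simp only [PiLp.add_apply, add_smul, lp.single_add, Finset.sum_add_distrib]
  map_smul' c x := by
    simp only [PiLp.smul_apply, smul_eq_mul, mul_smul, lp.single_smul, Finset.smul_sum,
      RingHom.id_apply]

lemma inner_diagEmbedding {m : ℕ} (u : Fin m → E) (x : EuclideanSpace ℂ (Fin m))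
    (f : lp (fun _ : ℤ => E) 2) :
    inner ℂ (diagEmbedding u x) f = ∑ i : Fin m, conj (x i) * inner ℂ (u i) (f (i : ℤ)) := by
  simp only [diagEmbedding, LinearMap.coe_mk, AddHom.coe_mk, sum_inner, lp.inner_single_left,
    inner_smul_left]

lemma diagEmbedding_apply {m : ℕ} (u : Fin m → E) (x : EuclideanSpace ℂ (Fin m)) (k : ℤ) :
    diagEmbedding u x k = ∑ j : Fin m, if k = (j : ℤ) then x j • u j else 0 := by
  simp only [diagEmbedding, LinearMap.coe_mk, AddHom.coe_mk, lp.coeFn_sum, Finset.sum_apply,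
    lp.single_apply, Pi.single_apply]

variable [CompleteSpace E]

/-- The bilateral backward shift as an element of the unitary group. -/
def shiftOp (E : Type u) [NormedAddCommGroup E] [InnerProductSpace ℂ E] [CompleteSpace E] :
    unitary (lp (fun _ : ℤ => E) 2 →L[ℂ] lp (fun _ : ℤ => E) 2) :=
  Unitary.linearIsometryEquiv.symm bilateralShift

lemma shiftOp_pow_apply (m : ℕ) (f : lp (fun _ : ℤ => E) 2) (k : ℤ) :
    (((shiftOp E : lp (fun _ : ℤ => E) 2 →L[ℂ] lp (fun _ : ℤ => E) 2) ^ m) f) k = f (k + m) := by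
  induction m generalizing k with
  | zero => simp
  | succ m ih =>
    rw [pow_succ']
    change (((shiftOp E : lp (fun _ : ℤ => E) 2 →L[ℂ] lp (fun _ : ℤ => E) 2) ^ m) f) (k + 1) = _
    rw [ih, show k + 1 + (m : ℤ) = k + ((m + 1 : ℕ) : ℤ) by push_cast; ring]

lemma inner_diagEmbedding_shiftOp {m : ℕ} (u : Fin m → E) (x y : EuclideanSpace ℂ (Fin m))
    (d : ℕ) :
    inner ℂ (diagEmbedding u x)
        (((shiftOp E : lp (fun _ : ℤ => E) 2 →L[ℂ] lp (fun _ : ℤ => E) 2) ^ d)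
          (diagEmbedding u y))
      = ∑ i : Fin m, ∑ j : Fin m,
          if (i : ℕ) + d = j then conj (x i) * y j * inner ℂ (u i) (u j) else 0 := by
  rw [inner_diagEmbedding]
  refine Finset.sum_congr rfl fun i _ => ?_
  rw [shiftOp_pow_apply, diagEmbedding_apply, inner_sum, Finset.mul_sum]
  refine Finset.sum_congr rfl fun j _ => ?_
  by_cases h : (i : ℕ) + d = j
  · rw [if_pos h, if_pos (by exact_mod_cast h), inner_smul_right]; ring
  · rw [if_neg h, if_neg (by exact_mod_cast h), inner_zero_right, mul_zero]

lemma inner_diagEmbedding_self {ρ : ℝ} (hρ : 0 < ρ) {m : ℕ} {b : ℝ} {u : Fin m → E}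
    (hu : ∀ i j, inner ℂ (u i) (u j) = (ρ : ℂ)⁻¹ * kernelMatrix ρ m b i j)
    (x y : EuclideanSpace ℂ (Fin m)) :
    inner ℂ (diagEmbedding u x) (diagEmbedding u y) = inner ℂ x y := by
  have hρ0 : (ρ : ℂ) ≠ 0 := by exact_mod_cast hρ.ne'
  have := inner_diagEmbedding_shiftOp u x y 0
  rw [pow_zero, one_apply_eq_self] at this
  rw [this, PiLp.inner_apply]
  refine Finset.sum_congr rfl fun i _ => ?_
  rw [Finset.sum_eq_single i]
  · rw [if_pos (by simp), hu, kernelMatrix, Matrix.of_apply, if_pos rfl, inv_mul_cancel₀ hρ0,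
      mul_one, RCLike.inner_apply']
  · intro j _ hj
    rw [if_neg]
    intro h'
    exact hj (Fin.ext (by simpa using h'.symm))
  · simp

lemma inner_truncShift_pow {ρ : ℝ} (hρ : 0 < ρ) {m : ℕ} {b : ℝ} {u : Fin m → E}
    (hu : ∀ i j, inner ℂ (u i) (u j) = (ρ : ℂ)⁻¹ * kernelMatrix ρ m b i j)
    (x y : EuclideanSpace ℂ (Fin m)) {d : ℕ} (hd : 1 ≤ d) :
    inner ℂ x ((toOp (truncShift m b) ^ d) y) = (ρ : ℂ) * inner ℂ (diagEmbedding u x)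
        (((shiftOp E : lp (fun _ : ℤ => E) 2 →L[ℂ] lp (fun _ : ℤ => E) 2) ^ d)
          (diagEmbedding u y)) := by
  have hρ0 : (ρ : ℂ) ≠ 0 := by exact_mod_cast hρ.ne'
  rw [inner_diagEmbedding_shiftOp, toOp_pow, inner_toOp, Finset.mul_sum]
  refine Finset.sum_congr rfl fun i _ => ?_
  rw [Finset.mul_sum]
  refine Finset.sum_congr rfl fun j _ => ?_
  rw [truncShift_pow_apply]
  split_ifs with hij
  · rw [hu, kernelMatrix, Matrix.of_apply, if_neg (fun e => by rw [e] at hij; omega),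
      show (i : ℕ) - j + (j - i) = d by omega]
    field_simp
  · simp

lemma exists_gram_kernelMatrix {ρ : ℝ} (hρ : 0 < ρ) {m : ℕ} {b : ℝ}
    (h : (toOp (kernelMatrix ρ m b)).IsPositive) :
    ∃ u : Fin m → EuclideanSpace ℂ (Fin m),
      ∀ i j, inner ℂ (u i) (u j) = (ρ : ℂ)⁻¹ * kernelMatrix ρ m b i j := by
  obtain ⟨B, hB⟩ := CStarAlgebra.nonneg_iff_eq_star_mul_self.1
    ((ContinuousLinearMap.nonneg_iff_isPositive _).2 h)
  refine ⟨fun k => (((√ρ)⁻¹ : ℝ) : ℂ) • B (EuclideanSpace.single k (1 : ℂ)), fun i j => ?_⟩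
  have h1 : inner ℂ (B (EuclideanSpace.single i (1 : ℂ))) (B (EuclideanSpace.single j (1 : ℂ)))
      = kernelMatrix ρ m b i j := by
    rw [← inner_single_toOp_single (kernelMatrix ρ m b) i j, hB,
      ContinuousLinearMap.star_eq_adjoint]
    exact (ContinuousLinearMap.adjoint_inner_right B _ _).symm
  rw [inner_smul_left, inner_smul_right, Complex.conj_ofReal, ← mul_assoc, h1,
    ← Complex.ofReal_mul, ← mul_inv, Real.mul_self_sqrt hρ.le, Complex.ofReal_inv]

/-- The embedding is `e_k ↦ δ_k ⊗ u_k`, isometric because `ρ⁻¹ K` has unit diagonal. The `d`-th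
power of the backward shift pairs `e_i` only with `e_(i+d)`, and there the Gram entry is `ρ⁻¹ b ^
d`. -/
lemma isRhoContraction_truncShift_of_gram {F : Type} [NormedAddCommGroup F]
    [InnerProductSpace ℂ F] [CompleteSpace F] {ρ : ℝ} (hρ : 0 < ρ) {m : ℕ} {b : ℝ} {u : Fin m → F}
    (hu : ∀ i j, inner ℂ (u i) (u j) = (ρ : ℂ)⁻¹ * kernelMatrix ρ m b i j) :
    IsRhoContraction ρ (toOp (truncShift m b)) := by
  refine ⟨lp (fun _ : ℤ => F) 2, inferInstance, inferInstance,
    inferInstance, (diagEmbedding u).isometryOfInner (inner_diagEmbedding_self hρ hu),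
    shiftOp F, (shiftOp F).2, fun d hd => ?_⟩
  refine ContinuousLinearMap.ext fun y => ext_inner_left ℂ fun x => ?_
  rw [inner_truncShift_pow hρ hu x y hd, smul_apply, inner_smul_right,
    ContinuousLinearMap.comp_apply, ContinuousLinearMap.adjoint_inner_right]
  rfl

lemma isRhoContraction_truncShift_of_isPositive {ρ : ℝ} (hρ : 0 < ρ) {m : ℕ} {b : ℝ}
    (h : (toOp (kernelMatrix ρ m b)).IsPositive) :
    IsRhoContraction ρ (toOp (truncShift m b)) := by
  obtain ⟨u, hu⟩ := exists_gram_kernelMatrix hρ h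
  exact isRhoContraction_truncShift_of_gram hρ hu

/-- The vectors `W ^ k J e_k` have Gram matrix `ρ⁻¹ K`: by unitarity their inner products depend
only on the power `W ^ (j - i)`, which the dilation property evaluates. -/
lemma isPositive_of_isRhoContraction_truncShift {ρ : ℝ} (hρ : 0 < ρ) {m : ℕ} {b : ℝ}
    (h : IsRhoContraction ρ (toOp (truncShift m b))) :
    (toOp (kernelMatrix ρ m b)).IsPositive := by
  obtain ⟨K, i1, i2, i3, J, W, hW, h⟩ := h
  rw [isPositive_iff_re_inner (isSelfAdjoint_toOp_kernelMatrix ρ m b)]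
  intro x
  let e : Fin m → EuclideanSpace ℂ (Fin m) := fun k => EuclideanSpace.single k (1 : ℂ)
  let w : Fin m → K := fun k => (W ^ (k : ℕ)) (J (e k))
  have hle : ∀ i j : Fin m, i ≤ j → (ρ : ℂ) * inner ℂ (w i) (w j) = kernelMatrix ρ m b i j := by
    intro i j hij
    obtain ⟨d, hd⟩ := Nat.exists_eq_add_of_le (Fin.le_def.1 hij)
    have h1 : inner ℂ (w i) (w j) = inner ℂ (J (e i)) ((W ^ d) (J (e j))) := by
      simp only [w]
      rw [hd, pow_add]
      exact ContinuousLinearMap.inner_map_map_of_mem_unitary (pow_mem hW _) _ _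
    rw [h1]
    rcases Nat.eq_zero_or_pos d with rfl | hd0
    · have : i = j := Fin.ext (by simpa using hd.symm)
      subst this
      rw [pow_zero, one_apply_eq_self, J.inner_map_map, kernelMatrix, Matrix.of_apply, if_pos rfl]
      simp [e]
    · have h2 := congrArg (fun A => inner ℂ (e i) (A (e j))) (h d hd0)
      simp only [smul_apply, inner_smul_right, ContinuousLinearMap.comp_apply,
        ContinuousLinearMap.adjoint_inner_right, toOp_pow] at h2
      rw [inner_single_toOp_single, truncShift_pow_apply, if_pos hd.symm] at h2
      rw [kernelMatrix, Matrix.of_apply, if_neg (fun e => by rw [e] at hd; omega),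
        show (i : ℕ) - j + (j - i) = d by omega]
      exact h2.symm
  have hall : ∀ i j : Fin m, (ρ : ℂ) * inner ℂ (w i) (w j) = kernelMatrix ρ m b i j := by
    intro i j
    rcases le_total i j with hij | hij
    · exact hle i j hij
    · rw [← kernelMatrix_conj, ← hle j i hij, map_mul, inner_conj_symm, Complex.conj_ofReal]
  have key : inner ℂ x (toOp (kernelMatrix ρ m b) x)
      = (ρ : ℂ) * inner ℂ (∑ k, x k • w k) (∑ k, x k • w k) := by
    rw [inner_toOp, sum_inner, Finset.mul_sum]
    refine Finset.sum_congr rfl fun i _ => ?_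
    rw [inner_sum, Finset.mul_sum]
    refine Finset.sum_congr rfl fun j _ => ?_
    rw [inner_smul_left, inner_smul_right, ← hall]
    ring
  rw [key, Complex.re_ofReal_mul]
  exact mul_nonneg hρ.le (inner_self_nonneg (𝕜 := ℂ))

lemma isRhoContraction_truncShift_iff {ρ : ℝ} (hρ : 0 < ρ) (m : ℕ) (b : ℝ) :
    IsRhoContraction ρ (toOp (truncShift m b)) ↔ (toOp (kernelMatrix ρ m b)).IsPositive :=
  ⟨isPositive_of_isRhoContraction_truncShift hρ, isRhoContraction_truncShift_of_isPositive hρ⟩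

end Dilation

/-! ### The extremal scale, where the kernel matrix becomes singular. -/

section Radius

open Filter Topology

lemma continuous_kernelMatrix_apply (ρ : ℝ) (m : ℕ) (i j : Fin m) :
    Continuous fun b : ℝ => kernelMatrix ρ m b i j := by
  simp only [kernelMatrix, Matrix.of_apply]
  split_ifs
  · exact continuous_const
  · exact Complex.continuous_ofReal.pow _

lemma continuous_re_inner_kernelMatrix (ρ : ℝ) (m : ℕ) (x : EuclideanSpace ℂ (Fin m)) :
    Continuous fun b : ℝ => (inner ℂ x (toOp (kernelMatrix ρ m b) x)).re := by
  simp_rw [inner_toOp]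
  exact Complex.continuous_re.comp (continuous_finsetSum _ fun i _ => continuous_finsetSum _
    fun j _ => continuous_const.mul (continuous_kernelMatrix_apply ρ m i j))

lemma re_inner_kernelMatrix_sub_le (ρ : ℝ) (m : ℕ) (b c : ℝ) (x : EuclideanSpace ℂ (Fin m)) :
    (inner ℂ x (toOp (kernelMatrix ρ m b) x)).re
        - (inner ℂ x (toOp (kernelMatrix ρ m c) x)).re
      ≤ (∑ i, ∑ j, ‖kernelMatrix ρ m b i j - kernelMatrix ρ m c i j‖) * ‖x‖ ^ 2 := by
  rw [← Complex.sub_re, inner_toOp, inner_toOp, ← Finset.sum_sub_distrib, Finset.sum_mul]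
  refine (Complex.re_le_norm _).trans ((norm_sum_le _ _).trans (Finset.sum_le_sum fun i _ => ?_))
  rw [← Finset.sum_sub_distrib, Finset.sum_mul]
  refine (norm_sum_le _ _).trans (Finset.sum_le_sum fun j _ => ?_)
  rw [← mul_sub, norm_mul, norm_mul, RCLike.norm_conj, mul_comm, sq]
  exact mul_le_mul_of_nonneg_left (mul_le_mul (PiLp.norm_apply_le x i) (PiLp.norm_apply_le x j)
    (norm_nonneg _) (norm_nonneg _)) (norm_nonneg _)

lemma eventually_isPositive_kernelMatrix {ρ : ℝ} {m : ℕ} {b₀ l : ℝ} (hl : 0 < l)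
    (h : ∀ x, l * ‖x‖ ^ 2 ≤ (inner ℂ x (toOp (kernelMatrix ρ m b₀) x)).re) :
    ∀ᶠ b in 𝓝 b₀, (toOp (kernelMatrix ρ m b)).IsPositive := by
  have hcont : Continuous fun b : ℝ =>
      ∑ i, ∑ j, ‖kernelMatrix ρ m b₀ i j - kernelMatrix ρ m b i j‖ :=
    continuous_finsetSum _ fun i _ => continuous_finsetSum _ fun j _ =>
      (continuous_const.sub (continuous_kernelMatrix_apply ρ m i j)).norm
  have hev := hcont.continuousAt.eventually_lt (x₀ := b₀) continuousAt_const
    (show _ < l by simpa using hl)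
  filter_upwards [hev] with b hb
  rw [isPositive_iff_re_inner (isSelfAdjoint_toOp_kernelMatrix ρ m b)]
  intro x
  have h1 := re_inner_kernelMatrix_sub_le ρ m b₀ b x
  have h2 := mul_le_mul_of_nonneg_right hb.le (sq_nonneg ‖x‖)
  linarith [h x]

lemma re_inner_kernelMatrix_zero (ρ : ℝ) (m : ℕ) (x : EuclideanSpace ℂ (Fin m)) :
    (inner ℂ x (toOp (kernelMatrix ρ m 0) x)).re = ρ * ‖x‖ ^ 2 := by
  have h : kernelMatrix ρ m 0 = (ρ : ℂ) • (1 : Matrix (Fin m) (Fin m) ℂ) := by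
    ext i j
    simp only [kernelMatrix, Matrix.of_apply, Matrix.smul_apply, Matrix.one_apply, smul_eq_mul]
    split_ifs with hij
    · rw [mul_one]
    · have : (i : ℕ) ≠ j := fun e => hij (Fin.ext e)
      rw [Complex.ofReal_zero, zero_pow (by omega), mul_zero]
  have h2 : toOp (kernelMatrix ρ m 0) = (ρ : ℂ) • 1 := by
    rw [h, toOp, map_smul, map_one]
  rw [h2, re_inner_smul_one, Complex.ofReal_re]

/-- On `e_0 - e_1` the form equals `2ρ - 2b`. This keeps the radius away from `0`, and it is where
`n ≥ 1` enters. -/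
lemma le_of_isPositive_kernelMatrix {ρ b : ℝ} {n : ℕ} (hn : 1 ≤ n)
    (h : (toOp (kernelMatrix ρ (n + 1) b)).IsPositive) : b ≤ ρ := by
  let i : Fin (n + 1) := ⟨0, by omega⟩
  let j : Fin (n + 1) := ⟨1, by omega⟩
  have h1 := (isPositive_iff_re_inner h.isSelfAdjoint).1 h
    (EuclideanSpace.single i (1 : ℂ) - EuclideanSpace.single j (1 : ℂ))
  simp only [map_sub, inner_sub_left, inner_sub_right, inner_single_toOp_single] at h1
  simp [kernelMatrix, i, j] at h1
  linarith

lemma ofReal_smul_toOp_truncShift_one (m : ℕ) (b : ℝ) :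
    (b : ℂ) • toOp (truncShift m 1) = toOp (truncShift m b) := by
  rw [toOp, ← map_smul]
  congr 1
  ext i j
  simp [truncShift]

/-- The `ρ`-radius of the truncated shift is attained, and there the kernel is singular. -/
lemma exists_normShift_eq {ρ : ℝ} (hρ : 0 < ρ) {n : ℕ} (hn : 1 ≤ n) :
    ∃ a : ℝ, 0 < a ∧ normShift ρ n = truncShift (n + 1) a ∧
      (toOp (kernelMatrix ρ (n + 1) a)).IsPositive ∧
      ∀ l > 0, ∃ x, (inner ℂ x (toOp (kernelMatrix ρ (n + 1) a) x)).re < l * ‖x‖ ^ 2 := by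
  let G : Set ℝ := {γ | 0 < γ ∧ (toOp (kernelMatrix ρ (n + 1) γ⁻¹)).IsPositive}
  have hG : rhoRadius ρ (toOp (truncShift (n + 1) 1)) = sInf G := by
    rw [rhoRadius]
    congr 1
    ext γ
    rw [Set.mem_ofPred_eq, ofReal_smul_toOp_truncShift_one, isRhoContraction_truncShift_iff hρ]
    rfl
  have hlow : ∀ γ ∈ G, ρ⁻¹ ≤ γ := fun γ hγ =>
    inv_le_of_inv_le₀ hγ.1 (le_of_isPositive_kernelMatrix hn hγ.2)
  have hbdd : BddBelow G := ⟨ρ⁻¹, hlow⟩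
  have hne : G.Nonempty := by
    have h0 := eventually_isPositive_kernelMatrix (m := n + 1) hρ
      fun x => (re_inner_kernelMatrix_zero ρ (n + 1) x).ge
    have h1 : ∀ᶠ b in 𝓝[>] (0 : ℝ), (toOp (kernelMatrix ρ (n + 1) b)).IsPositive :=
      h0.filter_mono nhdsWithin_le_nhds
    obtain ⟨b, hb, hb0⟩ := (h1.and self_mem_nhdsWithin).exists
    exact ⟨b⁻¹, inv_pos.2 hb0, by rwa [inv_inv]⟩
  set s := sInf G with hs
  have hspos : 0 < s := (inv_pos.2 hρ).trans_le (le_csInf hne hlow)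
  refine ⟨s⁻¹, inv_pos.2 hspos, by rw [normShift, hG], ?_, ?_⟩
  · rw [isPositive_iff_re_inner (isSelfAdjoint_toOp_kernelMatrix ρ (n + 1) s⁻¹)]
    intro x
    -- A negative value at the infimum `s` would persist near `s`, although `s` is a limit of points
    -- of `G`.
    by_contra! hneg
    have hc : ContinuousAt (fun γ : ℝ =>
        (inner ℂ x (toOp (kernelMatrix ρ (n + 1) γ⁻¹) x)).re) s :=
      ContinuousAt.comp (f := fun γ : ℝ => γ⁻¹)
        (continuous_re_inner_kernelMatrix ρ (n + 1) x).continuousAt (continuousAt_inv₀ hspos.ne')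
    have hev := hc.eventually_lt continuousAt_const hneg
    have hfr := mem_closure_iff_frequently.1 (csInf_mem_closure hne hbdd)
    obtain ⟨γ, hγ, hlt⟩ := (hfr.and_eventually hev).exists
    exact absurd ((isPositive_iff_re_inner hγ.2.isSelfAdjoint).1 hγ.2 x) (not_le.2 hlt)
  · intro l hl
    -- A positive lower bound at `s` would leave the matrix positive for some `γ < s`, against the
    -- choice of `s` as infimum.
    by_contra! hge
    have hev := (continuousAt_inv₀ hspos.ne').eventually
      (eventually_isPositive_kernelMatrix hl hge)
    have h1 : ∀ᶠ γ in 𝓝[<] s, 0 < γ ∧ (toOp (kernelMatrix ρ (n + 1) γ⁻¹)).IsPositive :=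
      ((lt_mem_nhds hspos).and hev).filter_mono nhdsWithin_le_nhds
    obtain ⟨γ, hγ, hlt⟩ := (h1.and self_mem_nhdsWithin).exists
    exact absurd (csInf_le hbdd hγ) (not_le.2 hlt)

/-- With `K = B⋆B` the form is `‖B x‖²`. In finite dimension an injective `B` would be bounded
below, contradicting the absence of a positive lower bound for the form. -/
lemma exists_normShift_factor {ρ : ℝ} (hρ : 0 < ρ) {n : ℕ} (hn : 1 ≤ n) :
    ∃ a : ℝ, 0 < a ∧ normShift ρ n = truncShift (n + 1) a ∧
      ∃ B : EuclideanSpace ℂ (Fin (n + 1)) →L[ℂ] EuclideanSpace ℂ (Fin (n + 1)),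
        toOp (kernelMatrix ρ (n + 1) a) = star B * B ∧ ∃ v, v ≠ 0 ∧ B v = 0 := by
  obtain ⟨a, ha, hS, hpos, hsing⟩ := exists_normShift_eq hρ hn
  obtain ⟨B, hB⟩ := CStarAlgebra.nonneg_iff_eq_star_mul_self.1
    ((ContinuousLinearMap.nonneg_iff_isPositive _).2 hpos)
  refine ⟨a, ha, hS, B, hB, ?_⟩
  by_contra! hinj
  obtain ⟨K, hK, hanti⟩ := B.toLinearMap.exists_antilipschitzWith
    (LinearMap.ker_eq_bot'.2 fun v hv => by_contra fun h => hinj v h hv)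
  obtain ⟨x, hx⟩ := hsing ((K : ℝ)⁻¹ ^ 2) (by positivity)
  have h1 : inner ℂ x (toOp (kernelMatrix ρ (n + 1) a) x) = inner ℂ (B x) (B x) := by
    rw [hB, ContinuousLinearMap.star_eq_adjoint]
    exact ContinuousLinearMap.adjoint_inner_right B _ _
  have h2 : ‖x‖ ≤ K * ‖B x‖ := by
    have := hanti.le_mul_dist x 0
    simpa using this
  rw [h1, show (inner ℂ (B x) (B x)).re = ‖B x‖ ^ 2 from inner_self_eq_norm_sq (𝕜 := ℂ) _,
    ← mul_pow] at hx
  have hKpos : (0 : ℝ) < K := hK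
  have h3 : (K : ℝ)⁻¹ * ‖x‖ ≤ ‖B x‖ := by
    rw [inv_mul_le_iff₀ hKpos]; exact h2
  have h4 := pow_le_pow_left₀ (by positivity) h3 2
  exact absurd hx (not_lt.2 h4)

end Radius

/-! ### The null line of the kernel and the operators preserving its rotations. -/

section Orbit

variable {n : ℕ} {ρ a : ℝ}

/-- The diagonal operator with entries `z ^ k`. -/
def diagRotation (m : ℕ) (z : ℂ) : EuclideanSpace ℂ (Fin m) →L[ℂ] EuclideanSpace ℂ (Fin m) :=
  toOp (Matrix.diagonal fun k : Fin m => z ^ (k : ℕ))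

lemma diagRotation_apply {m : ℕ} (z : ℂ) (x : EuclideanSpace ℂ (Fin m)) (k : Fin m) :
    diagRotation m z x k = z ^ (k : ℕ) * x k :=
  Matrix.mulVec_diagonal (fun k : Fin m => z ^ (k : ℕ)) x.ofLp k

lemma star_diagRotation (m : ℕ) (z : ℂ) : star (diagRotation m z) = diagRotation m (conj z) := by
  rw [diagRotation, toOp, ← map_star, Matrix.star_eq_conjTranspose, Matrix.diagonal_conjTranspose]
  congr 2
  ext k
  simp

lemma diagRotation_mul_conj (m : ℕ) {z : ℂ} (hz : ‖z‖ = 1) (x : EuclideanSpace ℂ (Fin m)) :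
    diagRotation m z (diagRotation m (conj z) x) = x := by
  have hc : z * conj z = 1 := by rw [Complex.mul_conj, Complex.normSq_eq_norm_sq, hz]; simp
  ext k
  rw [diagRotation_apply, diagRotation_apply, ← mul_assoc, ← mul_pow, hc, one_pow, one_mul]

lemma conj_mul_diagRotation (m : ℕ) {z : ℂ} (hz : ‖z‖ = 1) (x : EuclideanSpace ℂ (Fin m)) :
    diagRotation m (conj z) (diagRotation m z x) = x := by
  have := diagRotation_mul_conj m (z := conj z) (by rwa [RCLike.norm_conj]) x
  rwa [Complex.conj_conj] at this

lemma norm_diagRotation {m : ℕ} {z : ℂ} (hz : ‖z‖ = 1) (x : EuclideanSpace ℂ (Fin m)) :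
    ‖diagRotation m z x‖ = ‖x‖ := by
  rw [EuclideanSpace.norm_eq, EuclideanSpace.norm_eq]
  simp only [diagRotation_apply, norm_mul, norm_pow, hz, one_pow, one_mul]

variable {B : EuclideanSpace ℂ (Fin (n + 1)) →L[ℂ] EuclideanSpace ℂ (Fin (n + 1))}

lemma rhoKernel_apply_of_factor (hB : toOp (kernelMatrix ρ (n + 1) a) = star B * B) {z : ℂ}
    (hz : ‖z‖ = 1) (x : EuclideanSpace ℂ (Fin (n + 1))) :
    rhoKernel ρ z (toOp (truncShift (n + 1) a)) x
      = diagRotation (n + 1) z (star B (B (diagRotation (n + 1) (conj z) x))) := by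
  have hmul : ∀ A C : Matrix (Fin (n + 1)) (Fin (n + 1)) ℂ, toOp (A * C) = toOp A * toOp C :=
    fun A C => map_mul Matrix.toEuclideanCLM A C
  rw [rhoKernel_truncShift ρ (n + 1) a hz, hmul, hmul, hB]
  rfl

lemma kernelForm_of_factor (hB : toOp (kernelMatrix ρ (n + 1) a) = star B * B) {z : ℂ}
    (hz : ‖z‖ = 1) (x : EuclideanSpace ℂ (Fin (n + 1))) :
    kernelForm ρ (n + 1) z (toOp (truncShift (n + 1) a)) x
      = ‖B (diagRotation (n + 1) (conj z) x)‖ ^ 2 := by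
  rw [kernelForm_eq_re_inner ρ z (toOp_truncShift_pow_self _ _), rhoKernel_apply_of_factor hB hz,
    ← ContinuousLinearMap.adjoint_inner_left, ← ContinuousLinearMap.star_eq_adjoint,
    star_diagRotation, ContinuousLinearMap.star_eq_adjoint, ContinuousLinearMap.adjoint_inner_right]
  exact inner_self_eq_norm_sq (𝕜 := ℂ) _

lemma kernelMatrix_mulVec_of_factor (hB : toOp (kernelMatrix ρ (n + 1) a) = star B * B)
    {y : EuclideanSpace ℂ (Fin (n + 1))} (hy : B y = 0) :
    (kernelMatrix ρ (n + 1) a).mulVec y = 0 := by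
  have h : toOp (kernelMatrix ρ (n + 1) a) y = 0 := by
    rw [hB, show (star B * B) y = star B (B y) from rfl, hy, map_zero]
  exact congrArg (WithLp.ofLp) h

lemma apply_zero_ne_zero_of_factor (hB : toOp (kernelMatrix ρ (n + 1) a) = star B * B)
    (hρ : ρ ≠ 1) (ha : a ≠ 0) {v : EuclideanSpace ℂ (Fin (n + 1))} (hv : B v = 0) (hv0 : v ≠ 0) :
    v 0 ≠ 0 := fun h =>
  hv0 (PiLp.ext (congrFun
    (kernelMatrix_mulVec_eq_zero hρ ha (kernelMatrix_mulVec_of_factor hB hv) h)))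

lemma apply_last_ne_zero_of_factor (hB : toOp (kernelMatrix ρ (n + 1) a) = star B * B)
    (hρ : ρ ≠ 1) (ha : a ≠ 0) {v : EuclideanSpace ℂ (Fin (n + 1))} (hv : B v = 0) (hv0 : v ≠ 0) :
    v (Fin.last n) ≠ 0 := fun h =>
  hv0 (PiLp.ext (congrFun
    (kernelMatrix_mulVec_eq_zero_of_last hρ ha (kernelMatrix_mulVec_of_factor hB hv) h)))

/-- Subtracting the multiple of `v` with the same first coordinate leaves a null vector with first
coordinate zero, hence zero. -/
lemma exists_eq_smul_of_factor (hB : toOp (kernelMatrix ρ (n + 1) a) = star B * B)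
    (hρ : ρ ≠ 1) (ha : a ≠ 0) {v y : EuclideanSpace ℂ (Fin (n + 1))} (hv : B v = 0) (hv0 : v ≠ 0)
    (hy : B y = 0) : ∃ c : ℂ, y = c • v := by
  have h0 := apply_zero_ne_zero_of_factor hB hρ ha hv hv0
  refine ⟨y 0 / v 0, sub_eq_zero.1 (by_contra fun hne => ?_)⟩
  refine apply_zero_ne_zero_of_factor hB hρ ha (v := y - (y 0 / v 0) • v) ?_ hne ?_
  · rw [map_sub, map_smul, hy, hv, smul_zero, sub_zero]
  · simp only [PiLp.sub_apply, PiLp.smul_apply, smul_eq_mul]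
    field_simp
    ring

lemma toLp_pow_mul (z : ℂ) (v : EuclideanSpace ℂ (Fin (n + 1))) :
    (WithLp.toLp 2 fun k : Fin (n + 1) => z ^ (k : ℕ) * v k : EuclideanSpace ℂ (Fin (n + 1)))
      = diagRotation (n + 1) z v := by
  ext k
  rw [diagRotation_apply]

lemma isNullVector_of_factor (hS : normShift ρ n = truncShift (n + 1) a)
    (hB : toOp (kernelMatrix ρ (n + 1) a) = star B * B) (hρ : ρ ≠ 1) (ha : a ≠ 0)
    {v : EuclideanSpace ℂ (Fin (n + 1))} (hv : B v = 0) (hv0 : v ≠ 0) :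
    IsNullVector ρ n v := by
  refine ⟨fun h => hv0 (PiLp.ext (congrFun h)), fun z hz => ?_⟩
  rw [toLp_pow_mul, hS]
  ext x
  rw [LinearMap.mem_ker, Submodule.mem_span_singleton, ContinuousLinearMap.coe_coe]
  constructor
  · intro hx
    have h1 := kernelForm_of_factor hB hz x
    rw [kernelForm_eq_re_inner ρ z (toOp_truncShift_pow_self _ _), hx, inner_zero_right,
      Complex.zero_re] at h1
    have h2 : B (diagRotation (n + 1) (conj z) x) = 0 := by
      rw [← norm_eq_zero]; exact pow_eq_zero_iff two_ne_zero |>.1 h1.symm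
    obtain ⟨c, hc⟩ := exists_eq_smul_of_factor hB hρ ha hv hv0 h2
    refine ⟨c, ?_⟩
    rw [← map_smul, ← hc, diagRotation_mul_conj _ hz]
  · rintro ⟨c, rfl⟩
    rw [rhoKernel_apply_of_factor hB hz, map_smul, conj_mul_diagRotation _ hz, map_smul, hv, smul_zero,
      map_zero, map_zero]

lemma factor_apply_of_isNullVector (hS : normShift ρ n = truncShift (n + 1) a)
    (hB : toOp (kernelMatrix ρ (n + 1) a) = star B * B) {v : EuclideanSpace ℂ (Fin (n + 1))}
    (hv : IsNullVector ρ n v) : B v = 0 := by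
  have h := hv.2 1 (by simp)
  rw [toLp_pow_mul, hS] at h
  have hmem : diagRotation (n + 1) 1 v = v := by ext k; rw [diagRotation_apply]; simp
  rw [hmem] at h
  have h1 : rhoKernel ρ 1 (toOp (truncShift (n + 1) a)) v = 0 :=
    LinearMap.mem_ker.1 (h ▸ Submodule.mem_span_singleton_self v)
  have h2 := kernelForm_of_factor hB (z := 1) (by simp) v
  rw [kernelForm_eq_re_inner ρ 1 (toOp_truncShift_pow_self _ _), h1, inner_zero_right,
    Complex.zero_re, map_one, hmem] at h2
  rw [← norm_eq_zero]; exact pow_eq_zero_iff two_ne_zero |>.1 h2.symm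

/-- Write `D_z⋆ x = c v + w` with `w ⊥ v`. The eigenvector condition makes the `v` part vanish under
`B` on both sides, and on the orthogonal complement of `v` the injective `B` is bounded below by `1
/ K`. Rotations and `V` preserve norms, so the constant `‖B‖ K` does not depend on `z`. -/
lemma exists_kernelForm_map_le (hB : toOp (kernelMatrix ρ (n + 1) a) = star B * B)
    (hρ : ρ ≠ 1) (ha : a ≠ 0) {v : EuclideanSpace ℂ (Fin (n + 1))} (hv : B v = 0) (hv0 : v ≠ 0)
    {V : EuclideanSpace ℂ (Fin (n + 1)) →L[ℂ] EuclideanSpace ℂ (Fin (n + 1))}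
    (hV : ∀ x, ‖V x‖ = ‖x‖) {α : ℂ}
    (hα : ∀ z, ‖z‖ = 1 → V (diagRotation (n + 1) z v) = α • diagRotation (n + 1) z v) :
    ∃ c : ℝ, 1 ≤ c ∧ ∀ z : ℂ, ‖z‖ = 1 → ∀ x,
      kernelForm ρ (n + 1) z (toOp (truncShift (n + 1) a)) (V x)
        ≤ c ^ 2 * kernelForm ρ (n + 1) z (toOp (truncShift (n + 1) a)) x := by
  let P := Submodule.span ℂ {v}
  obtain ⟨K, hK, hanti⟩ := (B.toLinearMap.domRestrict Pᗮ).exists_antilipschitzWith (by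
    refine LinearMap.ker_eq_bot'.2 fun w hw => ?_
    obtain ⟨c, hc⟩ := exists_eq_smul_of_factor hB hρ ha hv hv0 (y := w) hw
    have h1 : (w : EuclideanSpace ℂ (Fin (n + 1))) ∈ P :=
      hc ▸ P.smul_mem c (Submodule.mem_span_singleton_self v)
    have h2 := P.inner_right_of_mem_orthogonal h1 w.2
    exact Subtype.ext (inner_self_eq_zero.1 h2))
  refine ⟨max 1 (‖B‖ * K), le_max_left _ _, fun z hz x => ?_⟩
  rw [kernelForm_of_factor hB hz, kernelForm_of_factor hB hz, ← mul_pow]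
  refine pow_le_pow_left₀ (norm_nonneg _) ?_ 2
  obtain ⟨p, hp, w, hw, hpw⟩ := P.exists_add_mem_mem_orthogonal (diagRotation (n + 1) (conj z) x)
  obtain ⟨c, rfl⟩ := Submodule.mem_span_singleton.1 hp
  have hx : x = diagRotation (n + 1) z (c • v + w) := by rw [← hpw, diagRotation_mul_conj _ hz]
  have hz' : ‖conj z‖ = 1 := by rwa [RCLike.norm_conj]
  have e1 : B (diagRotation (n + 1) (conj z) (V x))
      = B (diagRotation (n + 1) (conj z) (V (diagRotation (n + 1) z w))) := by
    rw [hx, map_add, map_smul, map_add, map_smul, hα z hz, map_add, map_smul, map_smul,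
      conj_mul_diagRotation _ hz, map_add, map_smul, map_smul, hv]
    simp
  have e2 : B (diagRotation (n + 1) (conj z) x) = B w := by
    rw [hpw, map_add, map_smul, hv, smul_zero, zero_add]
  have h3 : ‖w‖ ≤ K * ‖B w‖ := by
    have := hanti.le_mul_dist ⟨w, hw⟩ 0
    simpa using this
  rw [e1, e2]
  calc _ ≤ ‖B‖ * ‖diagRotation (n + 1) (conj z) (V (diagRotation (n + 1) z w))‖ := B.le_opNorm _
    _ = ‖B‖ * ‖w‖ := by rw [norm_diagRotation hz', hV, norm_diagRotation hz]
    _ ≤ ‖B‖ * (K * ‖B w‖) := mul_le_mul_of_nonneg_left h3 (norm_nonneg _)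
    _ = (‖B‖ * K) * ‖B w‖ := (mul_assoc _ _ _).symm
    _ ≤ _ := mul_le_mul_of_nonneg_right (le_max_right _ _) (norm_nonneg _)

/-- If a matrix maps every `(v_0, z v_1, …, z ^ n v_n)` to a multiple of itself, it acts as a
scalar on the basis vectors `e_k` with `v_k ≠ 0`. -/
lemma matrix_entry_of_forall_diagRotation {U : Matrix (Fin (n + 1)) (Fin (n + 1)) ℂ}
    {v : Fin (n + 1) → ℂ} (h0 : v 0 ≠ 0) (hlast : v (Fin.last n) ≠ 0)
    (h : ∀ z : ℂ, ‖z‖ = 1 → ∃ c : ℂ, ∀ i, ∑ j, U i j * (z ^ (j : ℕ) * v j)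
      = c * (z ^ (i : ℕ) * v i)) {j : Fin (n + 1)} (hj : v j ≠ 0) (i : Fin (n + 1)) :
    U i j = if i = j then U 0 0 else 0 := by
  let q : Fin (n + 1) → Polynomial ℂ := fun i =>
    ∑ j : Fin (n + 1), Polynomial.monomial (j : ℕ) (U i j * v j)
  have hq : ∀ i j : Fin (n + 1), (q i).coeff j = U i j * v j := by
    intro i j
    simp only [q, Polynomial.finsetSum_coeff, Polynomial.coeff_monomial, ← Fin.ext_iff]
    simp
  have hq' : ∀ (i : Fin (n + 1)) (k : ℕ), n < k → (q i).coeff k = 0 := by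
    intro i k hk
    simp only [q, Polynomial.finsetSum_coeff, Polynomial.coeff_monomial]
    exact Finset.sum_eq_zero fun j _ => if_neg (by have := j.2; omega)
  have hinf : {z : ℂ | ‖z‖ = 1}.Infinite := by
    have h1 : (Metric.sphere (0 : ℂ) 1).Infinite :=
      (isPreconnected_sphere (by rw [Complex.rank_real_complex]; norm_num) 0 1)
        |>.infinite_of_nontrivial ⟨1, by simp, -1, by simp, by norm_num⟩
    exact h1.mono fun z hz => by simpa using hz
  -- Row `0` eliminates the unknown factor `c(z)`; the resulting identity on the infinite unit
  -- circle is one of polynomials.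
  have hpoly : ∀ i, Polynomial.C (v 0) * q i = Polynomial.C (v i) * q 0 * Polynomial.X ^ (i : ℕ) := by
    intro i
    refine Polynomial.eq_of_infinite_eval_eq _ _ (hinf.mono fun z hz => ?_)
    obtain ⟨c, hc⟩ := h z hz
    have he : ∀ i, (q i).eval z = c * (z ^ (i : ℕ) * v i) := by
      intro i
      rw [← hc i]
      simp only [q, Polynomial.eval_finsetSum, Polynomial.eval_monomial]
      exact Finset.sum_congr rfl fun j _ => by ring
    change (Polynomial.C (v 0) * q i).eval z
      = (Polynomial.C (v i) * q 0 * Polynomial.X ^ (i : ℕ)).eval z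
    simp only [Polynomial.eval_mul, Polynomial.eval_C, Polynomial.eval_pow, Polynomial.eval_X, he]
    simp
    ring
  -- For `i = n` the right side is `v_n q_0 X ^ n` while the left has degree at most `n`; as `v_n ≠
  -- 0`, `q_0` is constant.
  have hq0 : ∀ d, d ≠ 0 → (q 0).coeff d = 0 := by
    intro d hd
    have h1 := congrArg (fun p => Polynomial.coeff p (d + n)) (hpoly (Fin.last n))
    simp only [Polynomial.coeff_C_mul, Fin.val_last, Polynomial.coeff_mul_X_pow] at h1
    rw [hq' _ _ (by omega), mul_zero] at h1
    exact (mul_eq_zero.1 h1.symm).resolve_left hlast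
  have h1 := congrArg (fun p => Polynomial.coeff p (j : ℕ)) (hpoly i)
  simp only [Polynomial.coeff_C_mul, hq, Polynomial.coeff_mul_X_pow'] at h1
  have h00 : (q 0).coeff 0 = U 0 0 * v 0 := hq 0 0
  split_ifs with hij
  · subst hij
    rw [if_pos le_rfl, Nat.sub_self, h00] at h1
    have h2 : v 0 * v i * (U i i - U 0 0) = 0 := by linear_combination h1
    exact sub_eq_zero.1 ((mul_eq_zero.1 h2).resolve_left (mul_ne_zero h0 hj))
  · have hne : (i : ℕ) ≠ j := fun e => hij (Fin.ext e)
    have h2 : v 0 * (U i j * v j) = 0 := by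
      rw [h1]
      split_ifs with hle
      · rw [hq0 _ (by omega), mul_zero]
      · rfl
    exact (mul_eq_zero.1 ((mul_eq_zero.1 h2).resolve_left h0)).resolve_right hj

end Orbit

end HarnackShift

end

/-! ### The orbit theorem. -/

theorem proposition3p4 (n : ℕ) (hn : 1 ≤ n) (ρ : ℝ) (hρ : 0 < ρ) (hρ1 : ρ ≠ 1) :
    (∃ v : Fin (n + 1) → ℂ, HarnackShift.IsNullVector ρ n v) ∧
    ∀ v : Fin (n + 1) → ℂ, HarnackShift.IsNullVector ρ n v →
      ∀ U : Matrix (Fin (n + 1)) (Fin (n + 1)) ℂ, U ∈ Matrix.unitaryGroup (Fin (n + 1)) ℂ →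
        (HarnackShift.HarnackEquivalent ρ
            (HarnackShift.toOp (U.conjTranspose * HarnackShift.normShift ρ n * U))
            (HarnackShift.toOp (HarnackShift.normShift ρ n)) ↔
          ∃ α : ℂ, ‖α‖ = 1 ∧
            ∀ k : Fin (n + 1), v k ≠ 0 →
              U.mulVec (Pi.single k 1) = α • (Pi.single k 1 : Fin (n + 1) → ℂ)) := by
  open HarnackShift ComplexConjugate in
  obtain ⟨a, ha, hS, B, hB, v₀, hv₀, hBv₀⟩ := exists_normShift_factor hρ hn
  refine ⟨⟨v₀, isNullVector_of_factor hS hB hρ1 ha.ne' hBv₀ hv₀⟩, fun v' hv' U hU => ?_⟩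
  obtain ⟨v, rfl⟩ : ∃ v : EuclideanSpace ℂ (Fin (n + 1)), v.ofLp = v' := ⟨WithLp.toLp 2 v', rfl⟩
  have hBv := factor_apply_of_isNullVector hS hB hv'
  have hv0 : v ≠ 0 := fun h => hv'.1 (congrArg WithLp.ofLp h)
  have h0 := apply_zero_ne_zero_of_factor hB hρ1 ha.ne' hBv hv0
  have hlast := apply_last_ne_zero_of_factor hB hρ1 ha.ne' hBv hv0
  set S := toOp (truncShift (n + 1) a) with hSdef
  set V := toOp U with hVdef
  have hV : V ∈ unitary _ := Unitary.map_mem Matrix.toEuclideanCLM hU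
  have hconj : toOp (U.conjTranspose * normShift ρ n * U) = star V * S * V := by
    rw [hS, ← Matrix.star_eq_conjTranspose, toOp, map_mul, map_mul, map_star]
    rfl
  rw [hconj, hS, ← hSdef]
  have hpow : S ^ (n + 1) = 0 := toOp_truncShift_pow_self _ _
  have hpow' : (star V * S * V) ^ (n + 1) = 0 := by
    rw [adjoint_mul_mul_pow hV, hpow, mul_zero, zero_mul]
  constructor
  -- Domination of `U⋆SU` by `S` alone suffices in this direction.
  · rintro ⟨hdom, -⟩
    obtain ⟨c, hc⟩ := hdom.exists_kernelForm_le hpow' hpow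
    have hrot : ∀ z : ℂ, ‖z‖ = 1 → ∃ c : ℂ, ∀ i, ∑ j, U i j * (z ^ (j : ℕ) * v j)
        = c * (z ^ (i : ℕ) * v i) := by
      intro z hz
      -- At `D_z v` the form of `S` vanishes, so the form of `U⋆SU` does too, which puts `U D_z v`
      -- on the null line `ℂ D_z v`.
      have h1 := hc z hz (diagRotation (n + 1) z v)
      rw [kernelForm_star_mul_mul _ _ _ hV, hSdef, kernelForm_of_factor hB hz,
        kernelForm_of_factor hB hz, conj_mul_diagRotation _ hz, hBv] at h1
      have h2 : B (diagRotation (n + 1) (conj z) (V (diagRotation (n + 1) z v))) = 0 := by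
        rw [← norm_eq_zero]
        refine pow_eq_zero_iff two_ne_zero |>.1 (le_antisymm (by simpa using h1) (sq_nonneg _))
      obtain ⟨d, hd⟩ := exists_eq_smul_of_factor hB hρ1 ha.ne' hBv hv0 h2
      refine ⟨d, fun i => ?_⟩
      have h3 := congrArg (diagRotation (n + 1) z) hd
      rw [diagRotation_mul_conj _ hz, map_smul] at h3
      have h4 := congrArg (fun x : EuclideanSpace ℂ (Fin (n + 1)) => x i) h3
      simp only [PiLp.smul_apply, smul_eq_mul, diagRotation_apply] at h4
      rw [← h4, hVdef, toOp_apply]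
      simp only [diagRotation_apply]
    have hent := fun (j : Fin (n + 1)) hj i =>
      matrix_entry_of_forall_diagRotation h0 hlast hrot (j := j) hj i
    have hcol : ∀ k : Fin (n + 1), v k ≠ 0 →
        U.mulVec (Pi.single k 1) = U 0 0 • (Pi.single k 1 : Fin (n + 1) → ℂ) := by
      intro k hk
      ext i
      rw [Matrix.mulVec_single_one, Matrix.col_apply, hent k hk i]
      simp [Pi.single_apply]
    refine ⟨U 0 0, ?_, hcol⟩
    -- Since `v_0 ≠ 0`, `e_0` is an eigenvector of the isometry `V` with eigenvalue `U 0 0`, which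
    -- is therefore unimodular.
    have h5 := norm_apply_of_mem_unitary hV (EuclideanSpace.single (0 : Fin (n + 1)) (1 : ℂ))
    have h6 : V (EuclideanSpace.single (0 : Fin (n + 1)) (1 : ℂ))
        = U 0 0 • EuclideanSpace.single (0 : Fin (n + 1)) (1 : ℂ) :=
      PiLp.ext (congrFun (hcol 0 h0))
    rw [h6, norm_smul] at h5
    simpa using h5
  · rintro ⟨α, hα, hcol⟩
    have hα0 : α ≠ 0 := fun h => by simp [h] at hα
    have hrot : ∀ z : ℂ, ‖z‖ = 1 →
        V (diagRotation (n + 1) z v) = α • diagRotation (n + 1) z v := by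
      intro z _
      ext i
      rw [hVdef, toOp_apply, PiLp.smul_apply, smul_eq_mul]
      rw [Finset.sum_eq_single i]
      · rw [diagRotation_apply]
        by_cases hi : v i = 0
        · simp [hi]
        · have := congrFun (hcol i hi) i
          rw [Matrix.mulVec_single_one, Matrix.col_apply] at this
          rw [this]
          simp
      · intro j _ hji
        rw [diagRotation_apply]
        by_cases hj : v j = 0
        · simp [hj]
        · have := congrFun (hcol j hj) i
          rw [Matrix.mulVec_single_one, Matrix.col_apply] at this
          rw [this]
          simp [hji.symm]
      · simp
    have hVs : ∀ x, V (star V x) = x := fun x =>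
      congrArg (fun A => A x) (Unitary.mem_iff.1 hV).2
    have hsV : ∀ x, star V (V x) = x := fun x =>
      congrArg (fun A => A x) (Unitary.mem_iff.1 hV).1
    -- The inverse of `V` has the same eigenvectors, which yields the reverse domination.
    have hrot' : ∀ z : ℂ, ‖z‖ = 1 →
        star V (diagRotation (n + 1) z v) = α⁻¹ • diagRotation (n + 1) z v := by
      intro z hz
      rw [eq_inv_smul_iff₀ hα0, ← map_smul, ← hrot z hz, hsV]
    have hC : IsRhoContraction ρ S := isRhoContraction_truncShift_of_isPositive hρ
      ((ContinuousLinearMap.nonneg_iff_isPositive _).1 (hB ▸ star_mul_self_nonneg B))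
    have hC' : IsRhoContraction ρ (star V * S * V) := hC.star_mul_mul hV
    obtain ⟨c₁, hc₁, h₁⟩ := exists_kernelForm_map_le hB hρ1 ha.ne' hBv hv0
      (norm_apply_of_mem_unitary hV) hrot
    obtain ⟨c₂, hc₂, h₂⟩ := exists_kernelForm_map_le hB hρ1 ha.ne' hBv hv0
      (norm_apply_of_mem_unitary (Unitary.star_mem hV)) hrot'
    refine ⟨harnackDominated_of_kernelForm_le hc₁ n.succ_pos hC' hC hpow' hpow fun z hz x => ?_,
      harnackDominated_of_kernelForm_le hc₂ n.succ_pos hC hC' hpow hpow' fun z hz x => ?_⟩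
    · rw [kernelForm_star_mul_mul _ _ _ hV]
      exact h₁ z hz x
    · rw [kernelForm_star_mul_mul _ _ _ hV]
      -- Substituting `V x` turns the bound for `V⋆` into a bound of the form of `S` by that of
      -- `V⋆SV`.
      have := h₂ z hz (V x)
      rwa [hsV] at this
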